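/- All graphs are finite, simple and undirected. For a graph $G$ let $I(G,x)=\sum_{k=0}^{\alpha(G)} i_k x^k$ be its independence polynomial, where $i_k$ is the number of independent sets of $G$ of size $k$ and $\alpha(G)$ is the independence number; its complex roots are called the independence roots of $G$. Let $\xi(G)$ denote the real number that is an independence root of $G$ of smallest modulus among all complex independence roots. Write $H\preceq G$ if $I(H,x)\ge I(G,x)$ for all $x\in[\xi(G),0]$, and $H\prec G$ if $H\preceq G$ and $I(H,x)\ne I(G,x)$ as polynomials. A graph is unicyclic if it contains exactly one cycle. For $n\ge 3$ let $C_n$ be the cycle on $n$ vertices, let $D_n$ be the graph with vertices $u_1,\dots,u_n$ consisting of the path $u_1u_2\cdots u_n$ and the additional edge $u_1u_3$, and let $U_n$ be the graph on $n$ vertices obtained from a triangle by attaching $n-3$ pendant vertices to one of its vertices (so $C_3=D_3=U_3$ and $D_4=U_4$). Theorem. Let $G$ be a connected unicyclic graph on $n$ vertices (so $n\ge 3$). Then: 1. $\xi(C_n)$, $\xi(G)$ and $\xi(U_n)$ are well defined, that is, each of $C_n$, $G$, $U_n$ has a real independence root whose modulus is smallest among all its complex independence roots. 2. If $G\not\cong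 C_n$, $G\not\cong D_n$ and $G\not\cong U_n$, then $C_n\prec G\prec U_n$. 3. In all cases, $\xi(C_n)\le\xi(G)\le\xi(U_n)$. -/

import Mathlib

namespace SimpleGraph

/-- The independence polynomial `I(G, x) = ∑_{k=0}^{α(G)} i_k x^k` of a finite graph, where `i_k` is
the number of independent sets of size `k` and `α(G)` is the independence number. -/
noncomputable def indepPoly {V : Type*} (G : SimpleGraph V) : Polynomial ℝ :=
  ∑ k ∈ Finset.range (G.indepNum + 1),
    Polynomial.C ((G.indepSetSet k).ncard : ℝ) * Polynomial.X ^ k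

/-- The real number `r` is an independence root of `G`, and it has smallest modulus among all
complex independence roots of `G`. -/
def IsMinModulusIndepRoot {V : Type*} (G : SimpleGraph V) (r : ℝ) : Prop :=
  Polynomial.aeval (r : ℂ) G.indepPoly = 0 ∧
    ∀ z : ℂ, Polynomial.aeval z G.indepPoly = 0 → ‖(r : ℂ)‖ ≤ ‖z‖

/-- `ξ(G)`: the (real) independence root of `G` of smallest modulus. -/
noncomputable def xi {V : Type*} (G : SimpleGraph V) : ℝ :=
  Classical.epsilon G.IsMinModulusIndepRoot

/-- `H ⪯ G`: `I(H, x) ≥ I(G, x)` for all `x ∈ [ξ(G), 0]`. -/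
def IndepLE {V W : Type*} (H : SimpleGraph V) (G : SimpleGraph W) : Prop :=
  ∀ x ∈ Set.Icc G.xi 0, H.indepPoly.eval x ≥ G.indepPoly.eval x

/-- `H ≺ G`: `H ⪯ G`, and the independence polynomials of `H` and `G` are different. -/
def IndepLT {V W : Type*} (H : SimpleGraph V) (G : SimpleGraph W) : Prop :=
  H.IndepLE G ∧ H.indepPoly ≠ G.indepPoly

/-- `G` has exactly one cycle (cycles are counted as subgraphs). -/
def IsUnicyclic {V : Type*} (G : SimpleGraph V) : Prop :=
  ∃! C : G.Subgraph, ∃ (u : V) (p : G.Walk u u), p.IsCycle ∧ p.toSubgraph = C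

/-- `D_n` (for `n ≥ 3`): the path `u_1 u_2 … u_n` together with the edge `u_1 u_3`, that is, a
triangle with a pendant path of length `n - 3` attached at one vertex. Here `u_i` is the
element `i - 1` of `Fin n`. -/
def graphD (n : ℕ) : SimpleGraph (Fin n) :=
  SimpleGraph.fromRel fun i j => i.val + 1 = j.val ∨ (i.val = 0 ∧ j.val = 2)

/-- `U_n` (for `n ≥ 3`): the triangle on `0, 1, 2` with the `n - 3` pendant vertices `3, …, n - 1`
attached to the vertex `0`. -/
def graphU (n : ℕ) : SimpleGraph (Fin n) :=
  SimpleGraph.fromRel fun i j => i.val = 0 ∨ (i.val = 1 ∧ j.val = 2)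

end SimpleGraph

set_option linter.unusedSectionVars false

/-! Put x = -t and write I(S) for the value at -t of the independence polynomial of the subgraph
induced on S. Everything rests on the deletion formula I(S) = I(S - v) - t I(S - v - N(v)). As long
as I(S) is positive on [0, t], all induced subgraphs have positive value at t (`posOn_of_pos`), so
deleting vertices never lowers the value (`PosOn.indepVal_anti`). The same recursion, with the
triangle inequality at a complex z, shows that the first zero on the positive t-axis gives a root of
least modulus (`PosOn.indepVal_mul_norm_le`).

Of unicyclicity, the inequalities use only connectedness and the equality of the numbers of vertices
and edges.

The bound by C_n comes from ratios. Let s = |S|, let W meet every component of S, and let P_k, C_k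
be the values for paths and cycles. Then I(S)/I(S \ W) is at most P_s/P_{s-1}
(`indepVal_mul_pathSeq_le`), and at most C_s/C_{s-1} if joining a new vertex to W gives a graph that
is not a tree (`indepVal_mul_cycleSeq_le`). Ratios suit induction: I(S)/I(S - w) is 1 - t divided by
the ratio for S - w and N(w), while components multiply their ratios (`seq_split_step`). The
condition t I(S \ W) < I(S) says that the graph with the new vertex still has positive value. If the
cycle closes only through the new vertex, two vertices of W in a connected S are deleted at once,
with bound P_s/P_{s-2} (`ConnOn.indepVal_mul_pathSeq_le_erase_erase`). Multiplying ratios along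
non-cut vertices gives `ConnOn.indepVal_le_cycleSeq`.

The bound by U_n (`ConnOn.indepVal_ge_of_unicyclic`) removes a non-cut vertex, of degree 1 or 2,
leaving a unicyclic graph or a tree; trees are bounded below by stars.

Equality of polynomials is traced through the deletion of a leaf. The coefficient of x^2 recovers
the number of edges, hence the degree of the leaf's neighbour: it is adjacent to everything in the
case of U_n, and extends the tail of a smaller D in the case of C_n. -/

namespace SimpleGraph

open Polynomial Finset

/-! ### Deletion formula, products and positivity for induced subgraphs. -/

section Polynomial

variable {V : Type*} [DecidableEq V] (G : SimpleGraph V) [DecidableRel G.Adj]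

/-- The vertices of `S` that are adjacent to `v`. -/
def nbrIn (v : V) (S : Finset V) : Finset V := S.filter (G.Adj v)

/-- The independence polynomial of the subgraph induced on `S`. -/
noncomputable def indepPolyOn (S : Finset V) : ℝ[X] :=
  ∑ T ∈ S.powerset, if G.IsIndepSet (T : Set V) then X ^ #T else 0

/-- The value at `-t` of the independence polynomial of the subgraph induced on `S`. -/
noncomputable def indepVal (S : Finset V) (t : ℝ) : ℝ := (G.indepPolyOn S).eval (-t)

variable {G}

@[simp] lemma mem_nbrIn {v a : V} {S : Finset V} : a ∈ G.nbrIn v S ↔ a ∈ S ∧ G.Adj v a := by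
  simp [nbrIn]

lemma nbrIn_subset (v : V) (S : Finset V) : G.nbrIn v S ⊆ S := filter_subset _ _

lemma indepPolyOn_empty : G.indepPolyOn ∅ = 1 := by
  simp [indepPolyOn]

lemma indepPolyOn_insert {v : V} {S : Finset V} (hv : v ∉ S) :
    G.indepPolyOn (insert v S) = G.indepPolyOn S + X * G.indepPolyOn (S \ G.nbrIn v S) := by
  unfold indepPolyOn
  rw [sum_powerset_insert hv, mul_sum]
  congr 1
  symm
  apply sum_subset_zero_on_sdiff (powerset_mono.2 sdiff_subset)
  · intro T hT
    rw [mem_sdiff, mem_powerset, mem_powerset] at hT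
    rw [if_neg]
    intro h
    apply hT.2
    intro a ha
    rw [mem_sdiff, mem_nbrIn]
    refine ⟨hT.1 ha, fun h' => ?_⟩
    have hva : v ≠ a := fun e => hv (e ▸ h'.1)
    exact h (by simp) (by simp [ha]) hva h'.2
  · intro T hT
    rw [mem_powerset] at hT
    have hvT : v ∉ T := fun h => hv (sdiff_subset (hT h))
    have hiff : G.IsIndepSet ((insert v T : Finset V) : Set V) ↔ G.IsIndepSet (T : Set V) := by
      constructor
      · intro h
        exact h.mono (by simp)
      · intro h a ha b hb hab
        rw [mem_coe, mem_insert] at ha hb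
        rcases ha with rfl | ha <;> rcases hb with rfl | hb
        · exact absurd rfl hab
        · have := hT hb
          rw [mem_sdiff, mem_nbrIn] at this
          exact fun h' => this.2 ⟨this.1, h'⟩
        · have := hT ha
          rw [mem_sdiff, mem_nbrIn] at this
          exact fun h' => this.2 ⟨this.1, h'.symm⟩
        · exact h ha hb hab
    by_cases h : G.IsIndepSet (T : Set V)
    · rw [if_pos h, if_pos (hiff.2 h), card_insert_of_notMem hvT, pow_succ']
    · rw [if_neg h, if_neg (fun h' => h (hiff.1 h')), mul_zero]

/-- Independent sets are split according to whether they contain `v`; this is the deletion formula.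
-/
lemma indepPolyOn_erase {v : V} {S : Finset V} (hv : v ∈ S) :
    G.indepPolyOn S =
      G.indepPolyOn (S.erase v) + X * G.indepPolyOn (S.erase v \ G.nbrIn v S) := by
  have h := indepPolyOn_insert (G := G) (notMem_erase v S)
  rw [insert_erase hv] at h
  rw [h]
  congr 3
  ext a
  simp only [mem_sdiff, mem_erase, mem_nbrIn]
  tauto

lemma indepVal_empty (t : ℝ) : G.indepVal ∅ t = 1 := by
  simp [indepVal, indepPolyOn_empty]

lemma indepVal_erase {v : V} {S : Finset V} (hv : v ∈ S) (t : ℝ) :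
    G.indepVal S t =
      G.indepVal (S.erase v) t - t * G.indepVal (S.erase v \ G.nbrIn v S) t := by
  unfold indepVal
  rw [indepPolyOn_erase hv]
  simp only [eval_add, eval_mul, eval_X]
  ring

lemma indepVal_insert {v : V} {S : Finset V} (hv : v ∉ S) (t : ℝ) :
    G.indepVal (insert v S) t = G.indepVal S t - t * G.indepVal (S \ G.nbrIn v S) t := by
  unfold indepVal
  rw [indepPolyOn_insert hv]
  simp only [eval_add, eval_mul, eval_X]
  ring

lemma indepVal_singleton (v : V) (t : ℝ) : G.indepVal {v} t = 1 - t := by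
  have h := indepVal_insert (G := G) (notMem_empty v) t
  rw [insert_empty_eq] at h
  rw [h, empty_sdiff, indepVal_empty, mul_one]

lemma indepVal_zero (S : Finset V) : G.indepVal S 0 = 1 := by
  induction S using Finset.induction_on with
  | empty => exact indepVal_empty 0
  | insert v S hv ih => rw [indepVal_insert hv, ih, zero_mul, sub_zero]

lemma continuous_indepVal (S : Finset V) : Continuous (G.indepVal S) := by
  unfold indepVal
  fun_prop

/-- The independence polynomial of a disjoint union without edges in between is a product. -/
lemma indepVal_union {A B : Finset V} (hd : Disjoint A B)
    (hAB : ∀ a ∈ A, ∀ b ∈ B, ¬ G.Adj a b) (t : ℝ) :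
    G.indepVal (A ∪ B) t = G.indepVal A t * G.indepVal B t := by
  induction A using Finset.strongInduction with
  | H A ih =>
    rcases A.eq_empty_or_nonempty with rfl | ⟨v, hv⟩
    · rw [empty_union, indepVal_empty, one_mul]
    · have hvB : v ∉ B := Finset.disjoint_left.1 hd hv
      have key : ∀ A' ⊆ A.erase v,
          G.indepVal (A' ∪ B) t = G.indepVal A' t * G.indepVal B t := fun A' hA' =>
        ih A' (lt_of_le_of_lt hA' (erase_ssubset hv))
          (hd.mono_left (hA'.trans (erase_subset _ _)))
          (fun a ha => hAB a (erase_subset _ _ (hA' ha)))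
      rw [indepVal_erase (mem_union_left B hv), indepVal_erase hv]
      have h1 : (A ∪ B).erase v = A.erase v ∪ B := by
        rw [erase_union_distrib, erase_eq_of_notMem hvB]
      have h2 : (A ∪ B).erase v \ G.nbrIn v (A ∪ B) = (A.erase v \ G.nbrIn v A) ∪ B := by
        ext a
        have := hAB v hv a
        have h3 : a ∈ B → a ≠ v := fun h e => hvB (e ▸ h)
        simp only [mem_sdiff, mem_erase, mem_union, mem_nbrIn]
        tauto
      rw [h2, h1, key _ subset_rfl, key _ sdiff_subset]
      ring

/-- Positivity at `-t` of the independence polynomials of all induced subgraphs on subsets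
of `S`. -/
def PosOn (G : SimpleGraph V) [DecidableRel G.Adj] (S : Finset V) (t : ℝ) : Prop :=
  0 ≤ t ∧ ∀ U ⊆ S, 0 < G.indepVal U t

lemma PosOn.mono {S U : Finset V} {t : ℝ} (h : G.PosOn S t) (hU : U ⊆ S) : G.PosOn U t :=
  ⟨h.1, fun W hW => h.2 W (hW.trans hU)⟩

lemma PosOn.pos {S : Finset V} {t : ℝ} (h : G.PosOn S t) : 0 < G.indepVal S t := h.2 S subset_rfl

/-- Deleting one vertex drops the term -t I(S - v - N(v)), which is nonpositive under `PosOn`. -/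
lemma PosOn.indepVal_anti {S U : Finset V} {t : ℝ} (h : G.PosOn S t) (hU : U ⊆ S) :
    G.indepVal S t ≤ G.indepVal U t := by
  induction S using Finset.strongInduction with
  | H S ih =>
    rcases hU.eq_or_ssubset with rfl | hlt
    · exact le_rfl
    · obtain ⟨v, hv, hvU⟩ := exists_of_ssubset hlt
      refine le_trans ?_ (ih (S.erase v) (erase_ssubset hv) (h.mono (erase_subset _ _))
        (subset_erase.2 ⟨hU, hvU⟩))
      rw [indepVal_erase hv]
      have := h.2 (S.erase v \ G.nbrIn v S) (sdiff_subset.trans (erase_subset _ _))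
      have := mul_nonneg h.1 this.le
      linarith

/-- A continuous function that is positive at `0` and not at `s` has a first zero. -/
lemma exists_first_zero {f : ℝ → ℝ} (hf : Continuous f) (h0 : 0 < f 0) {s : ℝ} (hs : 0 ≤ s)
    (hfs : f s ≤ 0) : ∃ r, 0 < r ∧ r ≤ s ∧ f r = 0 ∧ ∀ x, 0 ≤ x → x < r → 0 < f x := by
  have hc : IsCompact (Set.Icc 0 s ∩ {x | f x ≤ 0}) :=
    isCompact_Icc.inter_right (isClosed_le hf continuous_const)
  obtain ⟨r, ⟨⟨hr0, hrs⟩, hfr⟩, hmin⟩ := hc.exists_isLeast ⟨s, ⟨hs, le_rfl⟩, hfs⟩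
  have hlt : ∀ x, 0 ≤ x → x < r → 0 < f x := by
    intro x hx0 hxr
    by_contra hx
    exact absurd (hmin ⟨⟨hx0, hxr.le.trans hrs⟩, not_lt.1 hx⟩) (not_le.2 hxr)
  have hr : 0 < r := by
    rcases hr0.eq_or_lt with rfl | h
    · exact absurd hfr (not_le.2 h0)
    · exact h
  refine ⟨r, hr, hrs, le_antisymm hfr ?_, hlt⟩
  by_contra hneg
  obtain ⟨y, ⟨hy0, hyr⟩, hy⟩ :=
    intermediate_value_Icc' hr.le hf.continuousOn ⟨hfr, h0.le⟩
  rcases hyr.eq_or_lt with rfl | h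
  · exact hneg hy.ge
  · exact absurd hy (hlt y hy0 h).ne'

/-- A continuous function that is nonnegative on `[0, r)` is nonnegative at `r > 0`. -/
lemma nonneg_of_nonneg_on_Ico {f : ℝ → ℝ} (hf : Continuous f) {r : ℝ} (hr : 0 < r)
    (h : ∀ x, 0 ≤ x → x < r → 0 ≤ f x) : 0 ≤ f r := by
  have hcl : Set.Icc 0 r ⊆ {x | 0 ≤ f x} := by
    rw [← closure_Ico hr.ne]
    exact closure_minimal (fun x hx => h x hx.1 hx.2) (isClosed_le continuous_const hf)
  exact hcl ⟨hr.le, le_rfl⟩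

/-- Positivity on `[0, t]` passes to induced subgraphs. -/
lemma posOn_of_pos {S : Finset V} {t : ℝ} (ht : 0 ≤ t)
    (h : ∀ s, 0 ≤ s → s ≤ t → 0 < G.indepVal S s) : G.PosOn S t := by
  refine ⟨ht, ?_⟩
  induction S using Finset.strongInduction generalizing t with
  | H S ih =>
    intro U hU
    rcases hU.eq_or_ssubset with rfl | hlt
    · exact h t ht le_rfl
    · obtain ⟨v, hv, hvU⟩ := exists_of_ssubset hlt
      refine ih (S.erase v) (erase_ssubset hv) ht ?_ U (subset_erase.2 ⟨hU, hvU⟩)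
      intro s hs0 hst
      by_contra hneg
      -- At the first zero r of I(S - v), the smaller set S - v - N(v) still has value at least 0 by
      -- continuity, so the deletion formula gives I(S) ≤ 0 at r, a contradiction.
      obtain ⟨r, hr0, hrs, hr, hpos⟩ := exists_first_zero (continuous_indepVal (S.erase v))
        (by rw [indepVal_zero]; exact one_pos) hs0 (not_lt.1 hneg)
      have hN : 0 ≤ G.indepVal (S.erase v \ G.nbrIn v S) r :=
        nonneg_of_nonneg_on_Ico (continuous_indepVal _) hr0 fun x hx0 hxr =>
          (ih (S.erase v) (erase_ssubset hv) hx0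
            (fun y hy0 hyx => hpos y hy0 (hyx.trans_lt hxr)) _ sdiff_subset).le
      have h1 := h r hr0.le (hrs.trans hst)
      rw [indepVal_erase hv, hr] at h1
      have := mul_nonneg hr0.le hN
      linarith

/-- Each new vertex subtracts at least t times the current value, so it multiplies the value by at
most 1 - t, the factor of an isolated vertex. -/
lemma PosOn.le_pow {S : Finset V} {t : ℝ} (h : G.PosOn S t) (ht : t ≤ 1) :
    G.indepVal S t ≤ (1 - t) ^ #S := by
  induction S using Finset.induction_on with
  | empty => simp [indepVal_empty]
  | insert v S hv ih =>
    have hS := h.mono (subset_insert v S)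
    rw [indepVal_insert hv, card_insert_of_notMem hv, pow_succ]
    have h1 := ih hS
    have h2 := hS.indepVal_anti (sdiff_subset (s := S) (t := G.nbrIn v S))
    have h3 := mul_le_mul_of_nonneg_left h2 h.1
    have h4 := mul_le_mul_of_nonneg_right h1 (sub_nonneg.2 ht)
    linarith

end Polynomial

/-! ### Components, non-cut vertices and edge counts of induced subgraphs. -/

section Connectivity

variable {V : Type*} [DecidableEq V] (G : SimpleGraph V) [DecidableRel G.Adj]

/-- `U` is a union of connected components of the subgraph induced on `S`. -/
def ClosedIn (U S : Finset V) : Prop :=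
  U ⊆ S ∧ ∀ a ∈ U, ∀ b ∈ S, G.Adj a b → b ∈ U

/-- The subgraph induced on `S` has at most one connected component. -/
def ConnOn (S : Finset V) : Prop :=
  ∀ U, G.ClosedIn U S → U.Nonempty → U = S

/-- Every connected component of the subgraph induced on `S` meets `W`. -/
def MeetsComponents (W S : Finset V) : Prop :=
  W ⊆ S ∧ ∀ U, G.ClosedIn U S → U.Nonempty → (U ∩ W).Nonempty

/-- The sum of the degrees in the subgraph induced on `S`. -/
def degSum (S : Finset V) : ℕ := ∑ a ∈ S, #(G.nbrIn a S)

variable {G}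

lemma ClosedIn.trans {A B C : Finset V} (h : G.ClosedIn A B) (h' : G.ClosedIn B C) :
    G.ClosedIn A C :=
  ⟨h.1.trans h'.1, fun a ha b hb hab => h.2 a ha b (h'.2 a (h.1 ha) b hb hab) hab⟩

lemma ClosedIn.sdiff {A S : Finset V} (h : G.ClosedIn A S) : G.ClosedIn (S \ A) S := by
  refine ⟨sdiff_subset, fun a ha b hb hab => ?_⟩
  rw [mem_sdiff] at ha ⊢
  exact ⟨hb, fun hbA => ha.2 (h.2 b hbA a ha.1 hab.symm)⟩

lemma ClosedIn.not_adj {A S : Finset V} (h : G.ClosedIn A S) :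
    ∀ a ∈ A, ∀ b ∈ S \ A, ¬ G.Adj a b := fun a ha b hb hab => by
  rw [mem_sdiff] at hb
  exact hb.2 (h.2 a ha b hb.1 hab)

lemma ClosedIn.indepVal {A S : Finset V} (h : G.ClosedIn A S) (t : ℝ) :
    G.indepVal S t = G.indepVal A t * G.indepVal (S \ A) t := by
  rw [← indepVal_union disjoint_sdiff h.not_adj, union_sdiff_of_subset h.1]

lemma ClosedIn.indepVal_sdiff {A S : Finset V} (h : G.ClosedIn A S) (W : Finset V) (t : ℝ) :
    G.indepVal (S \ W) t = G.indepVal (A \ W) t * G.indepVal ((S \ A) \ W) t := by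
  rw [← indepVal_union (disjoint_sdiff.mono sdiff_subset sdiff_subset)
    (fun a ha b hb => h.not_adj a (sdiff_subset ha) b (sdiff_subset hb))]
  congr 1
  ext a
  have := @h.1 a
  simp only [mem_sdiff, mem_union]
  tauto

lemma MeetsComponents.of_closedIn {W A S : Finset V} (h : G.MeetsComponents W S)
    (hA : G.ClosedIn A S) : G.MeetsComponents (W ∩ A) A := by
  refine ⟨inter_subset_right, fun U hU hne => ?_⟩
  obtain ⟨x, hx⟩ := h.2 U (hU.trans hA) hne
  rw [mem_inter] at hx
  exact ⟨x, by simp [hx.1, hx.2, hU.1 hx.1]⟩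

/-- A component of S - w avoiding N(w) would already be a component of S. This lets the ratio bounds
recurse from S to S - w with W replaced by N(w). -/
lemma ConnOn.meetsComponents_nbrIn {S : Finset V} (h : G.ConnOn S) {w : V} (hw : w ∈ S) :
    G.MeetsComponents (G.nbrIn w (S.erase w)) (S.erase w) := by
  refine ⟨nbrIn_subset _ _, fun U hU hne => ?_⟩
  by_contra hcon
  rw [not_nonempty_iff_eq_empty] at hcon
  have hwU : w ∉ U := fun hwU => notMem_erase w S (hU.1 hwU)
  have hclosed : G.ClosedIn U S := by
    refine ⟨hU.1.trans (erase_subset _ _), fun a ha b hb hab => ?_⟩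
    by_cases hbw : b = w
    · subst hbw
      exfalso
      have : a ∈ U ∩ G.nbrIn b (S.erase b) := by
        rw [mem_inter, mem_nbrIn]
        exact ⟨ha, hU.1 ha, hab.symm⟩
      rw [hcon] at this
      exact notMem_empty _ this
    · exact hU.2 a ha b (mem_erase.2 ⟨hbw, hb⟩) hab
  exact hwU (h U hclosed hne ▸ hw)

lemma exists_closedIn_of_not_connOn {S : Finset V} (h : ¬ G.ConnOn S) :
    ∃ U, G.ClosedIn U S ∧ U.Nonempty ∧ U ⊂ S := by
  unfold ConnOn at h
  push Not at h
  obtain ⟨U, hU, hne, hneq⟩ := h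
  exact ⟨U, hU, hne, hU.1.ssubset_of_ne hneq⟩

/-- The connected component of a vertex. -/
lemma exists_component {S : Finset V} {w : V} (hw : w ∈ S) :
    ∃ K, G.ClosedIn K S ∧ w ∈ K ∧ G.ConnOn K := by
  classical
  obtain ⟨K, hK, hmin⟩ := exists_min_image
    (S.powerset.filter fun K => G.ClosedIn K S ∧ w ∈ K) card
    ⟨S, mem_filter.2 ⟨mem_powerset.2 subset_rfl, ⟨subset_rfl, fun _ _ b hb _ => hb⟩, hw⟩⟩
  simp only [mem_filter, mem_powerset] at hK hmin
  refine ⟨K, hK.2.1, hK.2.2, fun U hU hne => ?_⟩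
  by_contra hUK
  have hss := hU.1.ssubset_of_ne hUK
  by_cases hwU : w ∈ U
  · have := hmin U ⟨hU.1.trans hK.1, hU.trans hK.2.1, hwU⟩
    exact absurd (card_lt_card hss) (not_lt.2 this)
  · have := hmin (K \ U) ⟨sdiff_subset.trans hK.1, hU.sdiff.trans hK.2.1,
      mem_sdiff.2 ⟨hK.2.2, hwU⟩⟩
    rw [card_sdiff_of_subset hU.1] at this
    have h1 := hne.card_pos
    have h2 := card_le_card hU.1
    omega

lemma connOn_singleton (v : V) : G.ConnOn {v} := by
  intro U hU hne
  exact hne.subset_singleton_iff.1 hU.1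

lemma ConnOn.insert_of_adj {T : Finset V} (h : G.ConnOn T) {u x : V} (hx : x ∈ T)
    (hxu : G.Adj x u) : G.ConnOn (insert u T) := by
  intro U hU hne
  have hclosed : G.ClosedIn (U ∩ T) T := by
    refine ⟨inter_subset_right, fun a ha b hb hab => ?_⟩
    rw [mem_inter] at ha ⊢
    exact ⟨hU.2 a ha.1 b (mem_insert_of_mem hb) hab, hb⟩
  have hTU : T ⊆ U := by
    rcases (U ∩ T).eq_empty_or_nonempty with he | hn
    · exfalso
      have hu : u ∈ U := by
        obtain ⟨y, hy⟩ := hne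
        rcases mem_insert.1 (hU.1 hy) with rfl | hyT
        · exact hy
        · exact absurd (mem_inter.2 ⟨hy, hyT⟩) (by rw [he]; exact notMem_empty _)
      have := hU.2 u hu x (mem_insert_of_mem hx) hxu.symm
      exact absurd (mem_inter.2 ⟨this, hx⟩) (by rw [he]; exact notMem_empty _)
    · rw [← h _ hclosed hn]
      exact inter_subset_left
  refine Subset.antisymm hU.1 (insert_subset ?_ hTU)
  exact hU.2 x (hTU hx) u (mem_insert_self _ _) hxu

lemma ConnOn.exists_adj {S T : Finset V} (h : G.ConnOn S) (hT : T ⊂ S) (hne : T.Nonempty) :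
    ∃ a ∈ T, ∃ b ∈ S, b ∉ T ∧ G.Adj a b := by
  by_contra hcon
  push Not at hcon
  refine hT.ne (h T ⟨hT.subset, fun a ha b hb hab => ?_⟩ hne)
  by_contra hbT
  exact hcon a ha b hb hbT hab

/-- A connected graph with at least two vertices has a non-cut vertex. -/
lemma ConnOn.exists_connOn_erase {S : Finset V} (h : G.ConnOn S) (hS : 2 ≤ #S) :
    ∃ v ∈ S, G.ConnOn (S.erase v) := by
  classical
  obtain ⟨x, hx⟩ := card_pos.1 (by omega : 0 < #S)
  -- A largest proper nonempty connected subset misses exactly one vertex: adding an adjacent vertex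
  -- keeps it connected, so by maximality it must fill S.
  obtain ⟨T, hT, hmax⟩ := exists_max_image
    (S.powerset.filter fun T => G.ConnOn T ∧ T.Nonempty ∧ T ≠ S) card
    ⟨{x}, by
      simp only [mem_filter, mem_powerset, singleton_subset_iff]
      refine ⟨hx, connOn_singleton x, singleton_nonempty x, ?_⟩
      rintro rfl
      simp at hS⟩
  simp only [mem_filter, mem_powerset] at hT hmax
  obtain ⟨hTS, hTc, hTne, hTneq⟩ := hT
  obtain ⟨a, ha, b, hb, hbT, hab⟩ := h.exists_adj (hTS.ssubset_of_ne hTneq) hTne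
  have hbS : insert b T = S := by
    by_contra hne
    have := hmax (insert b T) ⟨insert_subset hb hTS, hTc.insert_of_adj ha hab, insert_nonempty _ _, hne⟩
    rw [card_insert_of_notMem hbT] at this
    omega
  exact ⟨b, hb, by rw [← hbS, erase_insert hbT]; exact hTc⟩

lemma nbrIn_erase_self (v : V) (S : Finset V) : G.nbrIn v (S.erase v) = G.nbrIn v S := by
  ext a
  simp only [mem_nbrIn, mem_erase]
  constructor
  · rintro ⟨⟨-, h⟩, h'⟩
    exact ⟨h, h'⟩
  · rintro ⟨h, h'⟩
    exact ⟨⟨h'.ne', h⟩, h'⟩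

lemma ConnOn.nbrIn_nonempty {S : Finset V} (h : G.ConnOn S) (hS : 2 ≤ #S) {v : V} (hv : v ∈ S) :
    (G.nbrIn v S).Nonempty := by
  obtain ⟨a, ha, b, hb, -, hab⟩ := h.exists_adj (T := {v})
    ((singleton_subset_iff.2 hv).ssubset_of_ne (by rintro rfl; simp at hS))
    (singleton_nonempty v)
  rw [mem_singleton] at ha
  subst ha
  exact ⟨b, by simp [hb, hab]⟩

lemma card_nbrIn_erase {a v : V} {S : Finset V} (hv : v ∈ S) :
    #(G.nbrIn a S) = #(G.nbrIn a (S.erase v)) + if G.Adj a v then 1 else 0 := by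
  have h : G.nbrIn a (S.erase v) = (G.nbrIn a S).erase v := by
    ext b
    simp only [mem_nbrIn, mem_erase]
    tauto
  rw [h]
  split_ifs with hav
  · rw [card_erase_add_one]
    simp [hv, hav]
  · rw [erase_eq_of_notMem, add_zero]
    simp [hav]

lemma degSum_erase {v : V} {S : Finset V} (hv : v ∈ S) :
    G.degSum S = G.degSum (S.erase v) + 2 * #(G.nbrIn v S) := by
  unfold degSum
  rw [← add_sum_erase S _ hv, sum_congr rfl (fun a _ => card_nbrIn_erase (a := a) hv),
    sum_add_distrib, sum_boole]
  have h : (S.erase v).filter (fun a => G.Adj a v) = G.nbrIn v S := by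
    rw [← nbrIn_erase_self]
    ext a
    simp [G.adj_comm]
  rw [h]
  simp only [Nat.cast_id]
  ring

lemma ClosedIn.degSum {A S : Finset V} (h : G.ClosedIn A S) :
    G.degSum S = G.degSum A + G.degSum (S \ A) := by
  have key : ∀ B, G.ClosedIn B S → ∑ a ∈ B, #(G.nbrIn a S) = G.degSum B := by
    intro B hB
    refine sum_congr rfl fun a ha => ?_
    congr 1
    ext b
    simp only [mem_nbrIn]
    exact ⟨fun hb => ⟨hB.2 a ha b hb.1 hb.2, hb.2⟩, fun hb => ⟨hB.1 hb.1, hb.2⟩⟩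
  rw [← key A h, ← key _ h.sdiff, add_comm, sum_sdiff h.1]
  rfl

/-- A connected graph on `n` vertices has at least `n - 1` edges. -/
lemma ConnOn.le_degSum {S : Finset V} (h : G.ConnOn S) : 2 * #S ≤ G.degSum S + 2 := by
  induction S using Finset.strongInduction with
  | H S ih =>
    rcases lt_or_ge (#S) 2 with hS | hS
    · omega
    · obtain ⟨v, hv, hc⟩ := h.exists_connOn_erase hS
      have h1 := ih _ (erase_ssubset hv) hc
      have h2 := (h.nbrIn_nonempty hS hv).card_pos
      rw [degSum_erase hv]
      rw [card_erase_of_mem hv] at h1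
      omega

/-- The coefficient of x^2 counts non-adjacent pairs, so the polynomial determines the number of
edges. This is what the equality cases exploit. -/
lemma two_mul_coeff_two_indepPolyOn (S : Finset V) :
    (G.indepPolyOn S).coeff 0 = 1 ∧ (G.indepPolyOn S).coeff 1 = #S ∧
      2 * (G.indepPolyOn S).coeff 2 = (#S : ℝ) * (#S - 1) - G.degSum S := by
  induction S using Finset.strongInduction with
  | H S ih =>
    rcases S.eq_empty_or_nonempty with rfl | ⟨v, hv⟩
    · simp [indepPolyOn_empty, coeff_one, degSum]
    · obtain ⟨h0, h1, h2⟩ := ih _ (erase_ssubset hv)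
      obtain ⟨h0', h1', -⟩ := ih (S.erase v \ G.nbrIn v S)
        (lt_of_le_of_lt sdiff_subset (erase_ssubset hv))
      have hc : #(S.erase v) + 1 = #S := card_erase_add_one hv
      have hsub : G.nbrIn v S ⊆ S.erase v := by
        rw [← nbrIn_erase_self]
        exact nbrIn_subset _ _
      have hc' := card_sdiff_add_card_eq_card hsub
      have hcR : (#(S.erase v) : ℝ) + 1 = #S := by exact_mod_cast hc
      have hcR' : (#(S.erase v \ G.nbrIn v S) : ℝ) + #(G.nbrIn v S) = #(S.erase v) := by
        exact_mod_cast hc'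
      have hd : (G.degSum S : ℝ) = G.degSum (S.erase v) + 2 * #(G.nbrIn v S) := by
        exact_mod_cast degSum_erase hv
      rw [indepPolyOn_erase hv]
      refine ⟨by simp [h0], ?_, ?_⟩
      · rw [coeff_add, coeff_X_mul, h1, h0', hcR]
      · rw [coeff_add, coeff_X_mul, h1', mul_add, h2, hd, ← hcR]
        linear_combination 2 * hcR'

end Connectivity

/-! ### Path and cycle recurrences and their identities. -/

section Sequences

/-- The value at `-t` of the independence polynomial of the path on `n - 2` vertices. -/
def pathSeq {R : Type*} [CommRing R] (t : R) : ℕ → R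
  | 0 => 0
  | 1 => 1
  | n + 2 => pathSeq t (n + 1) - t * pathSeq t n

/-- The value at `-t` of the independence polynomial of the cycle on `n` vertices. -/
def cycleSeq {R : Type*} [CommRing R] (t : R) : ℕ → R
  | 0 => 2
  | 1 => 1
  | n + 2 => cycleSeq t (n + 1) - t * cycleSeq t n

variable {R : Type*} [CommRing R] {t : R}

lemma pathSeq_add_two (n : ℕ) : pathSeq t (n + 2) = pathSeq t (n + 1) - t * pathSeq t n := rfl

lemma cycleSeq_add_two (n : ℕ) :
    cycleSeq t (n + 2) = cycleSeq t (n + 1) - t * cycleSeq t n := rfl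

lemma cycleSeq_succ (n : ℕ) : cycleSeq t (n + 1) = pathSeq t (n + 2) - t * pathSeq t n := by
  induction n using Nat.twoStepInduction with
  | zero => simp [cycleSeq, pathSeq]
  | one => simp [cycleSeq, pathSeq]; ring
  | more n h1 h2 =>
    rw [cycleSeq_add_two, h1, h2]
    simp only [pathSeq_add_two]
    ring

/-- A solution of the recurrence is determined by two consecutive terms, and `pathSeq` is the
fundamental solution. For u = `pathSeq` this is the splitting of a path at an edge. -/
lemma seq_add {u : ℕ → R} (hu : ∀ n, u (n + 2) = u (n + 1) - t * u n) (a b : ℕ) :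
    u (a + b + 1) = u (a + 1) * pathSeq t (b + 1) - t * u a * pathSeq t b := by
  induction b generalizing a with
  | zero => simp [pathSeq]
  | succ b ih =>
    have h := ih (a + 1)
    rw [show a + (b + 1) + 1 = a + 1 + b + 1 by ring, h, hu, pathSeq_add_two]
    ring

/-- Writing p for `pathSeq t`, this compares u(a+b+2)/u(a+b+1) with u(a+2)/u(a+1) · p(b+2)/p(b+1)
after clearing denominators; the sign of the right side decides which is larger. -/
lemma seq_cross {u : ℕ → R} (hu : ∀ n, u (n + 2) = u (n + 1) - t * u n) (a b : ℕ) :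
    u (a + b + 2) * u (a + 1) * pathSeq t (b + 1) - u (a + 2) * pathSeq t (b + 2) * u (a + b + 1)
      = t * u a * pathSeq t b * u (a + b + 3) := by
  have h1 := seq_add hu a b
  have h2 := seq_add hu (a + 1) b
  have h3 := seq_add hu (a + 1) (b + 1)
  rw [show a + b + 2 = a + 1 + b + 1 by ring, show a + b + 3 = a + 1 + (b + 1) + 1 by ring,
    h1, h2, h3, show a + 1 + 1 = a + 2 by ring, show b + 1 + 1 = b + 2 by ring, hu,
    pathSeq_add_two]
  ring

/-- With positive terms and t ≥ 0, consecutive ratios of `pathSeq` decrease with the index. -/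
lemma pathSeq_cross_one (i j : ℕ) :
    pathSeq t (j + 2) * pathSeq t (j + i + 1) - pathSeq t (j + i + 2) * pathSeq t (j + 1)
      = t ^ (j + 1) * pathSeq t i := by
  induction j with
  | zero =>
    simp only [zero_add, pathSeq_add_two]
    simp [pathSeq]
  | succ j ih =>
    rw [show j + 1 + 2 = j + 1 + 1 + 1 by ring, show j + 1 + i + 1 = j + i + 2 by ring,
      show j + 1 + i + 2 = j + i + 1 + 2 by ring, pathSeq_add_two (j + i + 1),
      pathSeq_add_two (j + 1), pow_succ, mul_right_comm, ← ih]
    simp only [add_assoc, Nat.reduceAdd]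
    ring

/-- The analogue for ratios of terms two apart, needed for cycles because C_{n+1} = P_n - t P_{n-2}.
-/
lemma pathSeq_cross_two (i j : ℕ) :
    pathSeq t (j + 2) * pathSeq t (j + i) - pathSeq t (j + i + 2) * pathSeq t j
      = t ^ j * pathSeq t i := by
  cases j with
  | zero => simp [pathSeq]
  | succ j =>
    have h := pathSeq_cross_one (t := t) i j
    rw [show j + 1 + i = j + i + 1 by ring, show j + 1 + 2 = j + 1 + 2 by ring,
      pathSeq_add_two (j + 1), pathSeq_add_two (j + i + 1), ← h]
    simp only [add_assoc, Nat.reduceAdd]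
    ring

lemma map_cycleSeq {R' : Type*} [CommRing R'] (f : R →+* R') (t : R) (n : ℕ) :
    f (cycleSeq t n) = cycleSeq (f t) n := by
  induction n using Nat.twoStepInduction with
  | zero => exact map_ofNat f 2
  | one => simp [cycleSeq]
  | more n h1 h2 => rw [cycleSeq_add_two, cycleSeq_add_two, map_sub, map_mul, h1, h2]

end Sequences

/-! ### Inequalities between products of ratios. -/

section RealSequences

variable {t : ℝ}

/-- The gluing step for disconnected sets: x/x' and y/y' are the ratios of the two pieces. It is
stated for any solution u so that the first piece can be compared with a path or with a cycle. -/
lemma seq_split_step {u : ℕ → ℝ} (hu : ∀ n, u (n + 2) = u (n + 1) - t * u n) (ht : 0 ≤ t)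
    {a b : ℕ} (ha : 0 ≤ u a) (ha1 : 0 < u (a + 1)) (ha2 : 0 < u (a + 2))
    (hb : ∀ j, 1 ≤ j → j ≤ b + 2 → 0 < pathSeq t j) {x x' y y' : ℝ} (hx : 0 < x)
    (hx' : 0 < x') (hy : 0 < y) (hy' : 0 < y')
    (hxu : x * u (a + 1) ≤ u (a + 2) * x')
    (hyh : y * pathSeq t (b + 1) ≤ pathSeq t (b + 2) * y') (hlt : t * (x' * y') < x * y) :
    (∀ j ≤ b, 0 < u (a + j + 3)) ∧
      x * y * u (a + b + 1) ≤ u (a + b + 2) * (x' * y') := by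
  have hb1 : 0 < pathSeq t (b + 1) := hb _ (by omega) (by omega)
  have hb2 : 0 < pathSeq t (b + 2) := hb _ (by omega) (by omega)
  have hb0 : ∀ j ≤ b, 0 ≤ pathSeq t j := by
    intro j hj
    rcases Nat.eq_zero_or_pos j with rfl | h
    · simp [pathSeq]
    · exact (hb j h (by omega)).le
  have hprod : x * y * (u (a + 1) * pathSeq t (b + 1)) ≤
      u (a + 2) * pathSeq t (b + 2) * (x' * y') := by
    have := mul_le_mul hxu hyh (by positivity) (by positivity)
    linarith
  -- By `seq_add` this is u(a+b+3) > 0; the monotonicity of path ratios then carries positivity down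
  -- to the intermediate terms.
  have hkey : t * (u (a + 1) * pathSeq t (b + 1)) < u (a + 2) * pathSeq t (b + 2) := by
    have h1 : t * (x' * y') * (u (a + 1) * pathSeq t (b + 1)) <
        x * y * (u (a + 1) * pathSeq t (b + 1)) := mul_lt_mul_of_pos_right hlt (by positivity)
    have h2 : t * (u (a + 1) * pathSeq t (b + 1)) * (x' * y') <
        u (a + 2) * pathSeq t (b + 2) * (x' * y') := by linarith
    exact lt_of_mul_lt_mul_right h2 (by positivity)
  have hpos : ∀ j ≤ b, 0 < u (a + j + 3) := by
    intro j hj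
    obtain ⟨i, rfl⟩ := Nat.exists_eq_add_of_le hj
    have hj1 : 0 < pathSeq t (j + 1) := hb _ (by omega) (by omega)
    have hc := pathSeq_cross_one (t := t) i j
    have hi : 0 ≤ t ^ (j + 1) * pathSeq t i := mul_nonneg (by positivity) (hb0 i (by omega))
    have h1 : pathSeq t (j + i + 2) * pathSeq t (j + 1) ≤
        pathSeq t (j + 2) * pathSeq t (j + i + 1) := by linarith
    have h3 := seq_add hu (a + 1) (j + 1)
    rw [show a + 1 + (j + 1) + 1 = a + j + 3 by ring] at h3
    have h4 : 0 < u (a + j + 3) * pathSeq t (j + i + 1) := by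
      have h5 := mul_le_mul_of_nonneg_left h1 ha2.le
      have h6 := mul_lt_mul_of_pos_right hkey hj1
      rw [h3]
      simp only [add_assoc, Nat.reduceAdd] at h5 h6 ⊢
      linarith
    exact pos_of_mul_pos_left h4 hb1.le
  refine ⟨hpos, ?_⟩
  have hab1 : 0 ≤ u (a + b + 1) := by
    match b, hpos with
    | 0, _ => exact ha1.le
    | 1, _ => exact ha2.le
    | b + 2, hpos => exact (hpos b (by omega)).le
  have hc := seq_cross hu a b
  have hnn : 0 ≤ t * u a * pathSeq t b * u (a + b + 3) :=
    mul_nonneg (mul_nonneg (mul_nonneg ht ha) (hb0 b le_rfl)) (hpos b le_rfl).le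
  have h1 := mul_le_mul_of_nonneg_right hprod hab1
  have h2 : u (a + 2) * pathSeq t (b + 2) * u (a + b + 1) ≤
      u (a + b + 2) * u (a + 1) * pathSeq t (b + 1) := by linarith
  have h3 := mul_le_mul_of_nonneg_right h2 (mul_pos hx' hy').le
  have h4 : x * y * u (a + b + 1) * (u (a + 1) * pathSeq t (b + 1)) ≤
      u (a + b + 2) * (x' * y') * (u (a + 1) * pathSeq t (b + 1)) := by linarith
  exact le_of_mul_le_mul_right h4 (by positivity)

lemma pathSeq_add_le {k l : ℕ} (hk : 0 ≤ pathSeq t k) (hl : 0 ≤ pathSeq t l) :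
    pathSeq t (k + 1 + l + 1) ≤ pathSeq t (k + 2) * pathSeq t (l + 2) := by
  have h := seq_add (t := t) pathSeq_add_two (k + 1) l
  have h1 := mul_nonneg (mul_nonneg (sq_nonneg t) hk) hl
  rw [h, show k + 1 + 1 = k + 2 by ring, pathSeq_add_two l, pathSeq_add_two k]
  linarith

/-- Passes from the two-vertex ratio of a path to the cycle ratio: with s = m + 2, P_s/P_{s-2} ≤
C_s/C_{s-1}, because the cross difference is t P_{s-4} C_{s+1} (the identity `hid`). -/
lemma cycleSeq_of_two_marked {m : ℕ} (ht : 0 ≤ t)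
    (hpos : ∀ j, 1 ≤ j → j ≤ m + 4 → 0 < pathSeq t j) {x y : ℝ} (hy : 0 < y)
    (hxy : x * pathSeq t (m + 2) ≤ pathSeq t (m + 4) * y) (hlt : t * y < x) :
    (∀ j ≤ m + 3, 0 < cycleSeq t j) ∧ x * cycleSeq t (m + 1) ≤ cycleSeq t (m + 2) * y := by
  have h2 := hpos (m + 2) (by omega) (by omega)
  have h4 := hpos (m + 4) (by omega) (by omega)
  have hm : 0 ≤ pathSeq t m := by
    rcases Nat.eq_zero_or_pos m with rfl | h
    · simp [pathSeq]
    · exact (hpos m h (by omega)).le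
  -- This difference is `cycleSeq t (m + 3)`; `pathSeq_cross_two` then yields the earlier cycle
  -- terms.
  have hkey : 0 < pathSeq t (m + 4) - t * pathSeq t (m + 2) := by
    have h5 := mul_lt_mul_of_pos_right hlt h2
    have h6 : t * pathSeq t (m + 2) * y < pathSeq t (m + 4) * y := by linarith
    have := lt_of_mul_lt_mul_right h6 hy.le
    linarith
  have hc : ∀ j ≤ m + 3, 0 < cycleSeq t j := by
    intro j hj
    match j, hj with
    | 0, _ => simp [cycleSeq]
    | 1, _ => simp [cycleSeq]
    | j + 2, hj =>
      obtain ⟨i, hi⟩ := Nat.exists_eq_add_of_le (by omega : j + 1 ≤ m + 2)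
      have hcr := pathSeq_cross_two (t := t) i (j + 1)
      rw [← hi] at hcr
      have hi0 : 0 ≤ pathSeq t i := by
        rcases Nat.eq_zero_or_pos i with rfl | h
        · simp [pathSeq]
        · exact (hpos i h (by omega)).le
      have hj1 := hpos (j + 1) (by omega) (by omega)
      have h6 : 0 ≤ t ^ (j + 1) * pathSeq t i := by positivity
      have h7 := mul_pos hkey hj1
      have h8 : 0 < cycleSeq t (j + 2) * pathSeq t (m + 2) := by
        rw [cycleSeq_succ (j + 1)]
        simp only [add_assoc, Nat.reduceAdd] at hcr h7 ⊢
        linarith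
      exact pos_of_mul_pos_left h8 h2.le
  refine ⟨hc, ?_⟩
  have hid : pathSeq t (m + 2) * cycleSeq t (m + 2) - pathSeq t (m + 4) * cycleSeq t (m + 1)
      = t * pathSeq t m * cycleSeq t (m + 3) := by
    rw [cycleSeq_succ m, cycleSeq_succ (m + 1), cycleSeq_succ (m + 2)]
    simp only [add_assoc, Nat.reduceAdd]
    rw [pathSeq_add_two (m + 2), show m + 2 + 1 = m + 1 + 2 by ring, pathSeq_add_two (m + 1),
      show m + 1 + 1 = m + 2 by ring, pathSeq_add_two m]
    ring
  have h5 := hc (m + 1) (by omega)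
  have h6 := hc (m + 3) (by omega)
  have h7 : 0 ≤ t * pathSeq t m * cycleSeq t (m + 3) := by positivity
  have h8 := mul_le_mul_of_nonneg_right hxy h5.le
  have h9 : pathSeq t (m + 4) * cycleSeq t (m + 1) * y ≤
      pathSeq t (m + 2) * cycleSeq t (m + 2) * y :=
    mul_le_mul_of_nonneg_right (by linarith) hy.le
  have h10 : x * cycleSeq t (m + 1) * pathSeq t (m + 2) ≤
      cycleSeq t (m + 2) * y * pathSeq t (m + 2) := by linarith
  exact le_of_mul_le_mul_right h10 h2

end RealSequences

/-! ### Ratio bounds by paths and cycles, and the comparison with C_n. -/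

section Lower

variable {V : Type*} [DecidableEq V] {G : SimpleGraph V} [DecidableRel G.Adj]

lemma indepVal_sdiff_inter (A W : Finset V) (t : ℝ) :
    G.indepVal (A \ (W ∩ A)) t = G.indepVal (A \ W) t := by
  congr 1
  ext a
  simp only [mem_sdiff, mem_inter]
  tauto

lemma erase_sdiff_nbrIn {S : Finset V} (w : V) :
    S.erase w \ G.nbrIn w (S.erase w) = S.erase w \ G.nbrIn w S := by
  rw [nbrIn_erase_self]

lemma ClosedIn.card {A S : Finset V} (h : G.ClosedIn A S) : #S = #A + #(S \ A) := by
  rw [add_comm, card_sdiff_add_card_eq_card h.1]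

lemma pathSeq_ratio_step {s : ℕ} {t p q P : ℝ} (ht : 0 ≤ t) (hP : P = p - t * q)
    (h : p * pathSeq t (s + 1) ≤ pathSeq t (s + 2) * q) :
    P * pathSeq t (s + 2) ≤ pathSeq t (s + 3) * p := by
  have h1 := mul_le_mul_of_nonneg_left h ht
  rw [pathSeq_add_two (s + 1), hP]
  linarith

/-- If every component of `S` meets `W`, then deleting `W` changes the independence polynomial at
`-t` at least as much as deleting an end vertex does for a path. -/
theorem indepVal_mul_pathSeq_le {S W : Finset V} {t : ℝ} (hS : G.PosOn S t)
    (hW : G.MeetsComponents W S) (hlt : t * G.indepVal (S \ W) t < G.indepVal S t) :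
    (∀ j, 1 ≤ j → j ≤ #S + 3 → 0 < pathSeq t j) ∧
      G.indepVal S t * pathSeq t (#S + 1) ≤ pathSeq t (#S + 2) * G.indepVal (S \ W) t := by
  induction S using Finset.strongInduction generalizing W with
  | H S ih =>
    have ht := hS.1
    rcases S.eq_empty_or_nonempty with rfl | hne
    · rw [empty_sdiff, indepVal_empty] at hlt
      rw [empty_sdiff, indepVal_empty]
      refine ⟨fun j hj1 hj3 => ?_, by simp [pathSeq]⟩
      rw [card_empty] at hj3
      interval_cases j <;> simp [pathSeq]
      linarith
    by_cases hc : G.ConnOn S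
    · obtain ⟨w, hw⟩ := hW.2 S ⟨subset_rfl, fun _ _ b hb _ => hb⟩ hne
      rw [mem_inter] at hw
      have hwS := hw.1
      have hE := indepVal_erase (G := G) hwS t
      have hpos := hS.pos
      have hS' := hS.mono (erase_subset w S)
      -- For S - w and N(w) the strict hypothesis reads I(S) > 0, by the deletion formula.
      obtain ⟨h1, h2⟩ := ih _ (erase_ssubset hwS) hS' (hc.meetsComponents_nbrIn hwS)
        (by rw [erase_sdiff_nbrIn]; linarith)
      rw [erase_sdiff_nbrIn] at h2
      have hcard : #S = #(S.erase w) + 1 := (card_erase_add_one hwS).symm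
      have hstep := pathSeq_ratio_step ht hE h2
      rw [hcard]
      have hle : G.indepVal (S.erase w) t ≤ G.indepVal (S \ W) t := by
        refine hS'.indepVal_anti (subset_erase.2 ⟨sdiff_subset, ?_⟩)
        simp [hw.2]
      have hq := hS.2 (S \ W) sdiff_subset
      have h3 := h1 (#(S.erase w) + 3) (by omega) le_rfl
      have h4 := h1 (#(S.erase w) + 2) (by omega) (by omega)
      have hfin : G.indepVal S t * pathSeq t (#(S.erase w) + 2) ≤
          pathSeq t (#(S.erase w) + 3) * G.indepVal (S \ W) t :=
        hstep.trans (mul_le_mul_of_nonneg_left hle h3.le)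
      refine ⟨fun j hj1 hj => ?_, hfin⟩
      rcases Nat.lt_or_ge j (#(S.erase w) + 4) with hj' | hj'
      · exact h1 j hj1 (by omega)
      · have hj4 : j = #(S.erase w) + 4 := by omega
        rw [hj4, pathSeq_add_two (#(S.erase w) + 2)]
        have h5 := mul_lt_mul_of_pos_right hlt h4
        have h6 : t * pathSeq t (#(S.erase w) + 2) * G.indepVal (S \ W) t <
            pathSeq t (#(S.erase w) + 3) * G.indepVal (S \ W) t := by linarith
        have := lt_of_mul_lt_mul_right h6 hq.le
        simp only [add_assoc, Nat.reduceAdd] at this ⊢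
        linarith
    · obtain ⟨A, hA, hAne, hAS⟩ := exists_closedIn_of_not_connOn hc
      have hB := hA.sdiff
      have hBS : S \ A ⊂ S := sdiff_ssubset hA.1 hAne
      have hPA := hS.mono hA.1
      have hPB := hS.mono hB.1
      have hv := hA.indepVal t
      have hvW := hA.indepVal_sdiff W t
      have pA := hPA.pos
      have pB := hPB.pos
      have pA' := hPA.2 (A \ W) sdiff_subset
      have pB' := hPB.2 ((S \ A) \ W) sdiff_subset
      have leA := hPA.indepVal_anti (sdiff_subset : A \ W ⊆ A)
      have leB := hPB.indepVal_anti (sdiff_subset : (S \ A) \ W ⊆ S \ A)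
      rw [hv, hvW] at hlt
      -- The other piece has ratio at most 1, so the strict inequality for the product passes to
      -- each factor.
      have ltA : t * G.indepVal (A \ W) t < G.indepVal A t := by
        refine lt_of_mul_lt_mul_right (lt_of_le_of_lt ?_ hlt) pB.le
        rw [mul_assoc]
        exact mul_le_mul_of_nonneg_left (mul_le_mul_of_nonneg_left leB pA'.le) ht
      have ltB : t * G.indepVal ((S \ A) \ W) t < G.indepVal (S \ A) t := by
        refine lt_of_mul_lt_mul_left (lt_of_le_of_lt ?_ hlt) pA.le
        rw [mul_left_comm]
        exact mul_le_mul_of_nonneg_left (mul_le_mul_of_nonneg_right leA pB'.le) ht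
      obtain ⟨a1, a2⟩ := ih A hAS hPA (hW.of_closedIn hA) (by rwa [indepVal_sdiff_inter])
      obtain ⟨b1, b2⟩ := ih _ hBS hPB (hW.of_closedIn hB) (by rwa [indepVal_sdiff_inter])
      rw [indepVal_sdiff_inter] at a2 b2
      have ha0 : 0 ≤ pathSeq t #A := (a1 _ hAne.card_pos (by omega)).le
      obtain ⟨c1, c2⟩ := seq_split_step pathSeq_add_two ht ha0 (a1 _ (by omega) (by omega))
        (a1 _ (by omega) (by omega)) (fun j h1 h2 => b1 j h1 (by omega)) pA pA' pB pB' a2 b2 hlt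
      rw [hv, hvW, hA.card]
      refine ⟨fun j h1 hj => ?_, c2⟩
      rcases Nat.lt_or_ge j (#A + 3) with hj' | hj'
      · exact a1 j h1 (by omega)
      · obtain ⟨i, rfl⟩ := Nat.exists_eq_add_of_le hj'
        rw [show #A + 3 + i = #A + i + 3 by ring]
        exact c1 i (by omega)

/-- Here W is a single vertex: the general bound is applied to S - w and N(w), followed by one ratio
step, so positivity of I(S) replaces the strict hypothesis. -/
lemma ConnOn.indepVal_mul_pathSeq_le {S : Finset V} {t : ℝ} (hc : G.ConnOn S)
    (hS : G.PosOn S t) {w : V} (hw : w ∈ S) :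
    (∀ j, 1 ≤ j → j ≤ #S + 2 → 0 < pathSeq t j) ∧
      G.indepVal S t * pathSeq t (#S + 1) ≤ pathSeq t (#S + 2) * G.indepVal (S.erase w) t := by
  have hE := indepVal_erase (G := G) hw t
  have hpos := hS.pos
  have hS' := hS.mono (erase_subset w S)
  obtain ⟨h1, h2⟩ := SimpleGraph.indepVal_mul_pathSeq_le hS' (hc.meetsComponents_nbrIn hw)
    (by rw [erase_sdiff_nbrIn]; linarith)
  rw [erase_sdiff_nbrIn] at h2
  rw [(card_erase_add_one hw).symm]
  exact ⟨fun j hj hj' => h1 j hj (by omega), pathSeq_ratio_step hS.1 hE h2⟩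

/-- Deleting two vertices of a connected graph changes the independence polynomial at `-t` at
least as much as deleting two vertices at an end does for a path. -/
theorem ConnOn.indepVal_mul_pathSeq_le_erase_erase {S : Finset V} {t : ℝ} (hc : G.ConnOn S)
    (hS : G.PosOn S t) {w w' : V} (hw : w ∈ S) (hw' : w' ∈ S) (hne : w ≠ w') :
    G.indepVal S t * pathSeq t #S ≤
      pathSeq t (#S + 2) * G.indepVal ((S.erase w).erase w') t := by
  have ht := hS.1
  have hpos := (hc.indepVal_mul_pathSeq_le hS hw).1
  have hw0 : w' ∈ S.erase w := mem_erase.2 ⟨hne.symm, hw'⟩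
  have hM := hc.meetsComponents_nbrIn hw
  have hE := indepVal_erase (G := G) hw t
  rw [← erase_sdiff_nbrIn] at hE
  have hScard := card_erase_add_one hw
  have hS0 := hS.mono (erase_subset w S)
  have hSpos := hS.pos
  set S₀ := S.erase w with hS₀
  set N := G.nbrIn w S₀
  obtain ⟨K, hK, hwK, hKc⟩ := exists_component (G := G) hw0
  have hR := hK.sdiff
  have hPK := hS0.mono hK.1
  have hPR := hS0.mono hR.1
  have pK := hPK.pos
  have pR := hPR.pos
  have pK' := hPK.2 (K \ N) sdiff_subset
  have pR' := hPR.2 ((S₀ \ K) \ N) sdiff_subset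
  have pKE := hPK.2 (K.erase w') (erase_subset _ _)
  have leK := hPK.indepVal_anti (sdiff_subset : K \ N ⊆ K)
  have leR := hPR.indepVal_anti (sdiff_subset : (S₀ \ K) \ N ⊆ S₀ \ K)
  rw [hK.indepVal t, hK.indepVal_sdiff N t] at hE
  have hEE := hK.indepVal_sdiff {w'} t
  rw [sdiff_singleton_eq_erase, sdiff_singleton_eq_erase, sdiff_singleton_eq_erase,
    erase_eq_of_notMem (s := S₀ \ K) (by simp [hwK])] at hEE
  have hlt : t * (G.indepVal (K \ N) t * G.indepVal ((S₀ \ K) \ N) t) <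
    G.indepVal K t * G.indepVal (S₀ \ K) t := by linarith
  have ltK : t * G.indepVal (K \ N) t < G.indepVal K t := by
    refine lt_of_mul_lt_mul_right (lt_of_le_of_lt ?_ hlt) pR.le
    rw [mul_assoc]
    exact mul_le_mul_of_nonneg_left (mul_le_mul_of_nonneg_left leR pK'.le) ht
  have ltR : t * G.indepVal ((S₀ \ K) \ N) t < G.indepVal (S₀ \ K) t := by
    refine lt_of_mul_lt_mul_left (lt_of_le_of_lt ?_ hlt) pK.le
    rw [mul_left_comm]
    exact mul_le_mul_of_nonneg_left (mul_le_mul_of_nonneg_right leK pR'.le) ht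
  have a := (SimpleGraph.indepVal_mul_pathSeq_le hPK (hM.of_closedIn hK)
    (by rwa [indepVal_sdiff_inter])).2
  have b := (SimpleGraph.indepVal_mul_pathSeq_le hPR (hM.of_closedIn hR)
    (by rwa [indepVal_sdiff_inter])).2
  rw [indepVal_sdiff_inter] at a b
  have a' := (hKc.indepVal_mul_pathSeq_le hPK hwK).2
  have hcard : #S = #K + #(S₀ \ K) + 1 := by rw [← hScard, hK.card]
  obtain ⟨k, hk⟩ : ∃ k, #K = k + 1 := Nat.exists_eq_add_one.2 (card_pos.2 ⟨w', hwK⟩)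
  rw [hEE]
  set l := #(S₀ \ K)
  rw [hk] at a a'
  rw [hcard, hk] at hpos ⊢
  have nn : ∀ j ≤ k + 1 + l + 1, 0 ≤ pathSeq t j := by
    intro j hj
    rcases Nat.eq_zero_or_pos j with rfl | h
    · simp [pathSeq]
    · exact (hpos j h (by omega)).le
  have k2 := hpos (k + 1 + 1) (by omega) (by omega)
  have k3 := hpos (k + 1 + 2) (by omega) (by omega)
  have l1 := hpos (l + 1) (by omega) (by omega)
  have l2 := hpos (l + 2) (by omega) (by omega)
  have hm2 := hpos (k + 1 + l + 1 + 2) (by omega) (by omega)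
  have hadd := seq_add (t := t) pathSeq_add_two (k + 1 + 1) (l + 1)
  rw [show k + 1 + 1 + (l + 1) + 1 = k + 1 + l + 1 + 2 by ring] at hadd
  -- With |K| = k + 1 this is P_{|K|+l-1} ≤ P_{|K|-1} P_l: the path left after deleting two end
  -- vertices is compared with the pieces around w and w'.
  have hle : pathSeq t (k + 1 + l + 1) ≤ pathSeq t (k + 2) * pathSeq t (l + 2) :=
    pathSeq_add_le (nn k (by omega)) (nn l (by omega))
  have s1 := mul_le_mul a b (by positivity) (by positivity)
  have s2 := mul_le_mul_of_nonneg_left s1 ht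
  -- The ratio bounds for K and for the rest of S - w give I(S)/(I(K) I(rest)) ≤ 1 - t
  -- (P_{|K|-1}/P_{|K|})(P_{l-1}/P_l), which is P_{|K|+l+1}/(P_{|K|} P_l).
  have s3 : G.indepVal S t * (pathSeq t (k + 1 + 2) * pathSeq t (l + 2)) ≤
      G.indepVal K t * G.indepVal (S₀ \ K) t * pathSeq t (k + 1 + l + 1 + 2) := by
    rw [hE, hadd]
    simp only [add_assoc, Nat.reduceAdd] at s2 ⊢
    linarith
  have s4 := mul_le_mul_of_nonneg_right a' (mul_pos pR hm2).le
  have s5 := mul_le_mul_of_nonneg_right s3 k2.le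
  have s6 : G.indepVal S t * (pathSeq t (k + 2) * pathSeq t (l + 2)) * pathSeq t (k + 1 + 2) ≤
      pathSeq t (k + 1 + l + 1 + 2) * (G.indepVal (K.erase w') t * G.indepVal (S₀ \ K) t) *
        pathSeq t (k + 1 + 2) := by
    simp only [add_assoc, Nat.reduceAdd] at s4 s5 ⊢
    linarith
  exact (mul_le_mul_of_nonneg_left hle hSpos.le).trans (le_of_mul_le_mul_right s6 k3)

/-- If every component of `S` meets `W` and a vertex joined to `W` creates or sees a cycle, then
deleting `W` changes the independence polynomial at `-t` at least as much as for a cycle with a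
pendant path. -/
theorem indepVal_mul_cycleSeq_le {S W : Finset V} {t : ℝ} (hS : G.PosOn S t)
    (hW : G.MeetsComponents W S) (hlt : t * G.indepVal (S \ W) t < G.indepVal S t)
    (hcyc : 2 * #S < G.degSum S + 2 * #W) :
    ∃ m, #S = m + 2 ∧ (∀ j ≤ m + 3, 0 < cycleSeq t j) ∧
      G.indepVal S t * cycleSeq t (m + 1) ≤ cycleSeq t (m + 2) * G.indepVal (S \ W) t := by
  induction S using Finset.strongInduction generalizing W with
  | H S ih =>
    have ht := hS.1
    have hq := hS.2 (S \ W) sdiff_subset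
    rcases S.eq_empty_or_nonempty with rfl | hne
    · have := hW.1
      rw [subset_empty] at this
      simp [this, degSum] at hcyc
    by_cases hc : G.ConnOn S
    -- Either the connected set S already contains a cycle, and one vertex is deleted, or S has at
    -- most |S| - 1 edges; then `hcyc` forces two vertices in W and the two-vertex bound applies.
    · rcases Nat.lt_or_ge (2 * #S) (G.degSum S + 2) with hd | hd
      · obtain ⟨w, hw⟩ := hW.2 S ⟨subset_rfl, fun _ _ b hb _ => hb⟩ hne
        rw [mem_inter] at hw
        have hwS := hw.1
        have hE := indepVal_erase (G := G) hwS t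
        have hpos := hS.pos
        have hS' := hS.mono (erase_subset w S)
        have hcard : #S = #(S.erase w) + 1 := (card_erase_add_one hwS).symm
        have hds := degSum_erase (G := G) hwS
        obtain ⟨m, hm, h1, h2⟩ := ih _ (erase_ssubset hwS) hS' (hc.meetsComponents_nbrIn hwS)
          (by rw [erase_sdiff_nbrIn]; linarith) (by rw [nbrIn_erase_self]; omega)
        rw [erase_sdiff_nbrIn] at h2
        have hle : G.indepVal (S.erase w) t ≤ G.indepVal (S \ W) t := by
          refine hS'.indepVal_anti (subset_erase.2 ⟨sdiff_subset, ?_⟩)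
          simp [hw.2]
        have c3 := h1 (m + 3) le_rfl
        have c2 := h1 (m + 2) (by omega)
        have hstep : G.indepVal S t * cycleSeq t (m + 2) ≤
            cycleSeq t (m + 3) * G.indepVal (S.erase w) t := by
          have h3 := mul_le_mul_of_nonneg_left h2 ht
          rw [cycleSeq_add_two (m + 1), hE]
          linarith
        have hfin := hstep.trans (mul_le_mul_of_nonneg_left hle c3.le)
        refine ⟨m + 1, by omega, fun j hj => ?_, hfin⟩
        rcases Nat.lt_or_ge j (m + 4) with hj' | hj'
        · exact h1 j (by omega)
        · have hj4 : j = m + 4 := by omega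
          rw [hj4, cycleSeq_add_two (m + 2)]
          have h5 := mul_lt_mul_of_pos_right hlt c2
          have h6 : t * cycleSeq t (m + 2) * G.indepVal (S \ W) t <
              cycleSeq t (m + 3) * G.indepVal (S \ W) t := by linarith
          have := lt_of_mul_lt_mul_right h6 hq.le
          simp only [add_assoc, Nat.reduceAdd] at this ⊢
          linarith
      · obtain ⟨w, hw, w', hw', hww⟩ := one_lt_card.1 (by omega : 1 < #W)
        have hC := hc.indepVal_mul_pathSeq_le_erase_erase hS (hW.1 hw) (hW.1 hw') hww
        have hpos := (hc.indepVal_mul_pathSeq_le hS (hW.1 hw)).1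
        have h2W := card_le_card hW.1
        obtain ⟨m, hm⟩ := Nat.exists_eq_add_of_le (by omega : 2 ≤ #S)
        have hle : G.indepVal ((S.erase w).erase w') t ≤ G.indepVal (S \ W) t := by
          refine (hS.mono ((erase_subset _ _).trans (erase_subset _ _))).indepVal_anti
            (subset_erase.2 ⟨subset_erase.2 ⟨sdiff_subset, ?_⟩, ?_⟩) <;> simp [hw, hw']
        have hm' : #S = m + 2 := by omega
        rw [hm'] at hC hpos
        have h4 := hpos (m + 2 + 2) (by omega) (by omega)
        obtain ⟨h5, h6⟩ := cycleSeq_of_two_marked ht hpos hq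
          (hC.trans (mul_le_mul_of_nonneg_left hle h4.le)) hlt
        exact ⟨m, hm', h5, h6⟩
    · have step : ∀ A, G.ClosedIn A S → A.Nonempty → A ⊂ S →
          2 * #A < G.degSum A + 2 * #(W ∩ A) → ∃ m, #S = m + 2 ∧
          (∀ j ≤ m + 3, 0 < cycleSeq t j) ∧
          G.indepVal S t * cycleSeq t (m + 1) ≤
            cycleSeq t (m + 2) * G.indepVal (S \ W) t := by
        intro A hA hAne hAS hAcyc
        have hB := hA.sdiff
        have hPA := hS.mono hA.1
        have hPB := hS.mono hB.1
        have hv := hA.indepVal t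
        have hvW := hA.indepVal_sdiff W t
        have pA := hPA.pos
        have pB := hPB.pos
        have pA' := hPA.2 (A \ W) sdiff_subset
        have pB' := hPB.2 ((S \ A) \ W) sdiff_subset
        have leA := hPA.indepVal_anti (sdiff_subset : A \ W ⊆ A)
        have leB := hPB.indepVal_anti (sdiff_subset : (S \ A) \ W ⊆ S \ A)
        rw [hv, hvW] at hlt
        have ltA : t * G.indepVal (A \ W) t < G.indepVal A t := by
          refine lt_of_mul_lt_mul_right (lt_of_le_of_lt ?_ hlt) pB.le
          rw [mul_assoc]
          exact mul_le_mul_of_nonneg_left (mul_le_mul_of_nonneg_left leB pA'.le) ht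
        have ltB : t * G.indepVal ((S \ A) \ W) t < G.indepVal (S \ A) t := by
          refine lt_of_mul_lt_mul_left (lt_of_le_of_lt ?_ hlt) pA.le
          rw [mul_left_comm]
          exact mul_le_mul_of_nonneg_left (mul_le_mul_of_nonneg_right leA pB'.le) ht
        obtain ⟨m, hm, a1, a2⟩ := ih A hAS hPA (hW.of_closedIn hA)
          (by rwa [indepVal_sdiff_inter]) hAcyc
        obtain ⟨b1, b2⟩ := SimpleGraph.indepVal_mul_pathSeq_le hPB (hW.of_closedIn hB)
          (by rwa [indepVal_sdiff_inter])
        rw [indepVal_sdiff_inter] at a2 b2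
        obtain ⟨c1, c2⟩ := seq_split_step cycleSeq_add_two ht (a1 m (by omega)).le
          (a1 (m + 1) (by omega)) (a1 (m + 2) (by omega)) (fun j h1 h2 => b1 j h1 (by omega))
          pA pA' pB pB' a2 b2 hlt
        refine ⟨m + #(S \ A), by rw [hA.card, hm]; ring, fun j hj => ?_, ?_⟩
        · rcases Nat.lt_or_ge j (m + 3) with hj' | hj'
          · exact a1 j (by omega)
          · obtain ⟨i, rfl⟩ := Nat.exists_eq_add_of_le hj'
            rw [show m + 3 + i = m + i + 3 by ring]
            exact c1 i (by omega)
        · rw [hv, hvW]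
          exact c2
      obtain ⟨A, hA, hAne, hAS⟩ := exists_closedIn_of_not_connOn hc
      -- The excess in `hcyc` is additive over components, so one of the two pieces inherits it;
      -- that piece gets the cycle ratio and the other the path ratio.
      rcases Nat.lt_or_ge (2 * #A) (G.degSum A + 2 * #(W ∩ A)) with hAc | hAc
      · exact step A hA hAne hAS hAc
      · refine step (S \ A) hA.sdiff (sdiff_nonempty.2 hAS.2) (sdiff_ssubset hA.1 hAne) ?_
        have h1 := hA.degSum
        have h2 := hA.card
        have h3 : #W = #(W ∩ A) + #(W ∩ (S \ A)) := by
          rw [← inter_sdiff_assoc, inter_eq_left.2 hW.1, card_inter_add_card_sdiff]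
        omega

lemma connOn_empty : G.ConnOn ∅ := fun _ hU _ => subset_empty.1 hU.1

/-- Among connected graphs, paths have the largest independence polynomials. -/
theorem ConnOn.indepVal_le_pathSeq {S : Finset V} {t : ℝ} (hc : G.ConnOn S)
    (hS : G.PosOn S t) : G.indepVal S t ≤ pathSeq t (#S + 2) := by
  induction S using Finset.strongInduction with
  | H S ih =>
    rcases S.eq_empty_or_nonempty with rfl | ⟨x, hx⟩
    · simp [indepVal_empty, pathSeq]
    obtain ⟨v, hv, hvc⟩ : ∃ v ∈ S, G.ConnOn (S.erase v) := by
      rcases Nat.lt_or_ge (#S) 2 with h | h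
      · refine ⟨x, hx, ?_⟩
        have : #(S.erase x) = 0 := by
          have := card_erase_add_one hx
          omega
        rw [card_eq_zero.1 this]
        exact connOn_empty
      · exact hc.exists_connOn_erase h
    obtain ⟨h1, h2⟩ := hc.indepVal_mul_pathSeq_le hS hv
    have h3 := ih _ (erase_ssubset hv) hvc (hS.mono (erase_subset _ _))
    rw [show #(S.erase v) + 2 = #S + 1 by rw [← card_erase_add_one hv]] at h3
    have p1 := h1 (#S + 1) (by omega) (by omega)
    have p2 := h1 (#S + 2) (by omega) (by omega)
    exact le_of_mul_le_mul_right (h2.trans (mul_le_mul_of_nonneg_left h3 p2.le)) p1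

/-- Here S - v is the set and `v` plays the new vertex joined to N(v); one more recurrence step
raises the index. -/
lemma ConnOn.indepVal_mul_cycleSeq_le {S : Finset V} {t : ℝ} (hc : G.ConnOn S)
    (hS : G.PosOn S t) (hd : 2 * #S ≤ G.degSum S) {v : V} (hv : v ∈ S) :
    ∃ m, #S = m + 3 ∧ (∀ j ≤ m + 3, 0 < cycleSeq t j) ∧
      G.indepVal S t * cycleSeq t (m + 2) ≤ cycleSeq t (m + 3) * G.indepVal (S.erase v) t := by
  have hE := indepVal_erase (G := G) hv t
  have hpos := hS.pos
  have hS' := hS.mono (erase_subset v S)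
  have hcard := card_erase_add_one hv
  have hds := degSum_erase (G := G) hv
  obtain ⟨m, hm, h1, h2⟩ := SimpleGraph.indepVal_mul_cycleSeq_le hS'
    (hc.meetsComponents_nbrIn hv) (by rw [erase_sdiff_nbrIn]; linarith)
    (by rw [nbrIn_erase_self]; omega)
  rw [erase_sdiff_nbrIn] at h2
  refine ⟨m, by omega, h1, ?_⟩
  have h3 := mul_le_mul_of_nonneg_left h2 hS.1
  rw [cycleSeq_add_two (m + 1), hE]
  linarith

/-- Among connected graphs that are not trees, cycles have the largest independence
polynomials. -/
theorem ConnOn.indepVal_le_cycleSeq {S : Finset V} {t : ℝ} (hc : G.ConnOn S)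
    (hS : G.PosOn S t) (hd : 2 * #S ≤ G.degSum S) : G.indepVal S t ≤ cycleSeq t #S := by
  induction S using Finset.strongInduction with
  | H S ih =>
    rcases S.eq_empty_or_nonempty with rfl | ⟨x, hx⟩
    · simp [indepVal_empty, cycleSeq]
    obtain ⟨m, hm, -⟩ := hc.indepVal_mul_cycleSeq_le hS hd hx
    obtain ⟨v, hv, hvc⟩ := hc.exists_connOn_erase (by omega)
    have hS' := hS.mono (erase_subset v S)
    have hcard := card_erase_add_one hv
    have hds := degSum_erase (G := G) hv
    -- If S - v has too few edges for induction, then `v` has two neighbours; deleting both from the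
    -- connected set S - v gives the factor P_s - t P_{s-2} = C_{s+1}, where s = |S - v|.
    rcases Nat.lt_or_ge (G.degSum (S.erase v)) (2 * #(S.erase v)) with hlt | hge
    · obtain ⟨w, hw, w', hw', hww⟩ := one_lt_card.1 (by omega : 1 < #(G.nbrIn v S))
      rw [← nbrIn_erase_self] at hw hw'
      have hwm := nbrIn_subset _ _ hw
      have hC := hvc.indepVal_mul_pathSeq_le_erase_erase hS' hwm (nbrIn_subset _ _ hw') hww
      have hpos := (hvc.indepVal_mul_pathSeq_le hS' hwm).1
      have hP := hvc.indepVal_le_pathSeq hS'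
      have hE := indepVal_erase (G := G) hv t
      have hSp := hS.pos
      rw [← erase_sdiff_nbrIn] at hE
      have hle : G.indepVal (((S.erase v).erase w).erase w') t ≤
          G.indepVal (S.erase v \ G.nbrIn v (S.erase v)) t := by
        refine (hS'.mono ((erase_subset _ _).trans (erase_subset _ _))).indepVal_anti
          (subset_erase.2 ⟨subset_erase.2 ⟨sdiff_subset, ?_⟩, ?_⟩) <;> simp [hw, hw']
      rw [show #S = #(S.erase v) + 1 from hcard.symm, cycleSeq_succ]
      have h2 := hpos (#(S.erase v) + 2) (by omega) (by omega)
      have hp := hS'.pos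
      set s := #(S.erase v)
      have h3 : G.indepVal S t * pathSeq t (s + 2) ≤
          G.indepVal (S.erase v) t * (pathSeq t (s + 2) - t * pathSeq t s) := by
        have h4 := mul_le_mul_of_nonneg_left
          (hC.trans (mul_le_mul_of_nonneg_left hle h2.le)) hS.1
        rw [hE]
        linarith
      have h5 : 0 < pathSeq t (s + 2) - t * pathSeq t s :=
        pos_of_mul_pos_right ((mul_pos hSp h2).trans_le h3) hp.le
      have h6 := mul_le_mul_of_nonneg_right hP h5.le
      refine le_of_mul_le_mul_right (h3.trans (h6.trans ?_)) h2
      rw [mul_comm]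
    · obtain ⟨m, hm, h1, h2⟩ := hc.indepVal_mul_cycleSeq_le hS hd hv
      have h3 := ih _ (erase_ssubset hv) hvc hS' hge
      rw [show #(S.erase v) = m + 2 by omega] at h3
      rw [hm]
      exact le_of_mul_le_mul_right (h2.trans (mul_le_mul_of_nonneg_left h3
        (h1 (m + 3) le_rfl).le)) (h1 (m + 2) (by omega))

end Lower

/-! ### Comparison with stars and U_n, and equality with U_n. -/

section Upper

variable {V : Type*} [DecidableEq V] {G : SimpleGraph V} [DecidableRel G.Adj]

lemma card_nbrIn_lt {S : Finset V} {v : V} (hv : v ∈ S) : #(G.nbrIn v S) < #S := by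
  refine card_lt_card ⟨nbrIn_subset _ _, fun h => ?_⟩
  have := h hv
  rw [mem_nbrIn] at this
  exact G.irrefl this.2

lemma degSum_le (S : Finset V) : G.degSum S ≤ #S * (#S - 1) := by
  refine (sum_le_card_nsmul S _ (#S - 1) fun a ha => ?_).trans_eq (smul_eq_mul ..)
  have := card_nbrIn_lt (G := G) ha
  omega

lemma exists_adj_of_degSum_pos {S : Finset V} (h : 0 < G.degSum S) :
    ∃ a ∈ S, ∃ b ∈ S, G.Adj a b := by
  by_contra hcon
  push Not at hcon
  refine h.ne' (sum_eq_zero fun a ha => card_eq_zero.2 ?_)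
  ext b
  simp only [mem_nbrIn, notMem_empty, iff_false, not_and]
  exact hcon a ha b

lemma card_erase_sdiff_nbrIn {S : Finset V} {v : V} (hv : v ∈ S) :
    #(S.erase v \ G.nbrIn v S) + #(G.nbrIn v S) + 1 = #S := by
  rw [card_sdiff_add_card_eq_card, card_erase_add_one hv]
  rw [← nbrIn_erase_self]
  exact nbrIn_subset _ _

/-- As in `PosOn.le_pow`, but vertices are peeled off only until one edge remains, which has value 1
- 2t. -/
lemma PosOn.le_of_adj {S : Finset V} {t : ℝ} (h : G.PosOn S t) (ht : t ≤ 1) {a b : V}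
    (ha : a ∈ S) (hb : b ∈ S) (hab : G.Adj a b) {m : ℕ} (hm : #S = m + 2) :
    G.indepVal S t ≤ (1 - t) ^ m * (1 - 2 * t) := by
  have hsub : ({a, b} : Finset V) ⊆ S := by
    simp [insert_subset_iff, ha, hb]
  have hc2 : #({a, b} : Finset V) = 2 := card_pair hab.ne
  induction m generalizing S with
  | zero =>
    have hS := eq_of_subset_of_card_le hsub (by omega)
    have hn : ({b} : Finset V) \ G.nbrIn a {b} = ∅ := by
      ext x
      simp only [mem_sdiff, mem_singleton, mem_nbrIn, notMem_empty, iff_false]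
      rintro ⟨rfl, h⟩
      exact h ⟨rfl, hab⟩
    rw [← hS, indepVal_insert (by simpa using hab.ne), indepVal_singleton, hn, indepVal_empty]
    apply le_of_eq
    ring
  | succ m ih =>
    obtain ⟨v, hv, hvab⟩ := exists_mem_notMem_of_card_lt_card (by omega : #({a, b} : Finset V) < #S)
    have hsub' : ({a, b} : Finset V) ⊆ S.erase v := subset_erase.2 ⟨hsub, hvab⟩
    have hS' := h.mono (erase_subset v S)
    have h1 := ih hS' (hsub' (by simp)) (hsub' (by simp))
      (by have := card_erase_add_one hv; omega) hsub'
    have h2 := hS'.indepVal_anti (sdiff_subset (s := S.erase v) (t := G.nbrIn v S))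
    rw [indepVal_erase hv, pow_succ]
    have h3 := mul_le_mul_of_nonneg_left h2 h.1
    have h4 := mul_le_mul_of_nonneg_right h1 (sub_nonneg.2 ht)
    linarith

/-- Among trees, stars have the smallest independence polynomials. -/
theorem ConnOn.star_le_indepVal {S : Finset V} {t : ℝ} (hc : G.ConnOn S) {m : ℕ}
    (hm : #S = m + 1) (hd : G.degSum S + 2 = 2 * #S) (ht : 0 ≤ t) (ht1 : t ≤ 1)
    (hpos : 0 < (1 - t) ^ m - t) : (1 - t) ^ m - t ≤ G.indepVal S t := by
  induction m generalizing S t with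
  | zero =>
    obtain ⟨v, rfl⟩ := card_eq_one.1 hm
    simp [indepVal_singleton]
  | succ m ih =>
    obtain ⟨v, hv, hvc⟩ := hc.exists_connOn_erase (by omega)
    have hcard := card_erase_add_one hv
    have hds := degSum_erase (G := G) hv
    have h1 := hvc.le_degSum
    have h2 := (hc.nbrIn_nonempty (by omega) hv).card_pos
    have hc' := card_erase_sdiff_nbrIn (G := G) hv
    have hmono : (1 - t) ^ (m + 1) ≤ (1 - t) ^ m :=
      pow_le_pow_of_le_one (by linarith) (by linarith) (by omega)
    -- The bound is needed on all of [0, t], since `posOn_of_pos` asks for positivity throughout the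
    -- interval.
    have key : ∀ s, 0 ≤ s → s ≤ t → (1 - s) ^ m - s ≤ G.indepVal (S.erase v) s ∧
        0 < (1 - s) ^ m - s := by
      intro s hs hst
      have h3 : (1 - t) ^ m ≤ (1 - s) ^ m := pow_le_pow_left₀ (by linarith) (by linarith) m
      have h4 : 0 < (1 - s) ^ m - s := by linarith
      exact ⟨ih hvc (by omega) (by omega) hs (by linarith) h4, h4⟩
    have hP : G.PosOn (S.erase v) t :=
      posOn_of_pos ht fun s hs hst => (key s hs hst).2.trans_le (key s hs hst).1
    have h5 := (hP.mono (sdiff_subset (t := G.nbrIn v S))).le_pow ht1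
    rw [show #(S.erase v \ G.nbrIn v S) = m by omega] at h5
    have h6 := (key t ht le_rfl).1
    have h7 := mul_le_mul_of_nonneg_left h5 ht
    rw [indepVal_erase hv, pow_succ]
    linarith

/-- With n = |S|, deleting the leaf leaves n - 1 edges, and its neighbour has at most n - 2 further
neighbours, so an edge survives. -/
lemma exists_adj_erase_sdiff {S : Finset V} {v : V} (hv : v ∈ S) (hS : 3 ≤ #S)
    (hd : G.degSum S = 2 * #S) (hN : #(G.nbrIn v S) = 1) :
    ∃ a ∈ S.erase v \ G.nbrIn v S, ∃ b ∈ S.erase v \ G.nbrIn v S, G.Adj a b := by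
  obtain ⟨w, hw⟩ := card_eq_one.1 hN
  have hwS : w ∈ S.erase v := by
    have : w ∈ G.nbrIn v (S.erase v) := by rw [nbrIn_erase_self, hw]; simp
    exact nbrIn_subset _ _ this
  have h1 := degSum_erase (G := G) hv
  have h2 := degSum_erase (G := G) hwS
  have h3 := card_nbrIn_lt (G := G) hwS
  have h4 := card_erase_add_one hv
  refine exists_adj_of_degSum_pos ?_
  rw [hw, sdiff_singleton_eq_erase]
  omega

/-- Among connected unicyclic graphs, the triangle with pendant vertices attached at one vertex
has the smallest independence polynomial. -/
theorem ConnOn.indepVal_ge_of_unicyclic {S : Finset V} {t : ℝ} (hc : G.ConnOn S) {m : ℕ}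
    (hm : #S = m + 3) (hd : G.degSum S = 2 * #S) (ht : 0 ≤ t) (ht1 : 2 * t ≤ 1)
    (hpos : 0 < (1 - t) ^ m * (1 - 2 * t) - t) :
    (1 - t) ^ m * (1 - 2 * t) - t ≤ G.indepVal S t := by
  induction m generalizing S t with
  | zero =>
    obtain ⟨v, hv, hvc⟩ := hc.exists_connOn_erase (by omega)
    have hcard := card_erase_add_one hv
    have hds := degSum_erase (G := G) hv
    have hc' := card_erase_sdiff_nbrIn (G := G) hv
    have h1 := degSum_le (G := G) (S.erase v)
    rw [show #(S.erase v) = 2 by omega] at h1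
    have h2 : S.erase v \ G.nbrIn v S = ∅ := card_eq_zero.1 (by omega)
    rw [indepVal_erase hv, h2, indepVal_empty]
    have h3 := hvc.star_le_indepVal (t := t) (m := 1) (by omega) (by omega) ht (by linarith)
      (by linarith)
    linarith
  | succ m ih =>
    obtain ⟨v, hv, hvc⟩ := hc.exists_connOn_erase (by omega)
    have hcard := card_erase_add_one hv
    have hds := degSum_erase (G := G) hv
    have h1 := hvc.le_degSum
    have h2 := (hc.nbrIn_nonempty (by omega) hv).card_pos
    have hc' := card_erase_sdiff_nbrIn (G := G) hv
    -- S - v is connected, so it has at least |S| - 2 of the |S| edges: it is unicyclic in the first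
    -- case and a tree in the second.
    rcases (by omega : #(G.nbrIn v S) = 1 ∨ #(G.nbrIn v S) = 2) with hN | hN
    · obtain ⟨a, ha, b, hb, hab⟩ := exists_adj_erase_sdiff hv (by omega) hd hN
      have key : ∀ s, 0 ≤ s → s ≤ t →
          (1 - s) ^ m * (1 - 2 * s) - s ≤ G.indepVal (S.erase v) s ∧
          0 < (1 - s) ^ m * (1 - 2 * s) - s := by
        intro s hs hst
        have h3 : (1 - t) ^ (m + 1) ≤ (1 - s) ^ m :=
          (pow_le_pow_of_le_one (by linarith) (by linarith) (by omega)).trans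
            (pow_le_pow_left₀ (by linarith) (by linarith) m)
        have h4 : (1 - t) ^ (m + 1) * (1 - 2 * t) ≤ (1 - s) ^ m * (1 - 2 * s) :=
          mul_le_mul h3 (by linarith) (by linarith) (pow_nonneg (by linarith) _)
        have h5 : 0 < (1 - s) ^ m * (1 - 2 * s) - s := by linarith
        exact ⟨ih hvc (by omega) (by omega) hs (by linarith) h5, h5⟩
      have hP : G.PosOn (S.erase v) t :=
        posOn_of_pos ht fun s hs hst => (key s hs hst).2.trans_le (key s hs hst).1
      have h5 := (hP.mono (sdiff_subset (t := G.nbrIn v S))).le_of_adj (by linarith) ha hb hab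
        (m := m) (by omega)
      have h6 := (key t ht le_rfl).1
      have h7 := mul_le_mul_of_nonneg_left h5 ht
      rw [indepVal_erase hv, pow_succ]
      linarith
    · have key : ∀ s, 0 ≤ s → s ≤ t →
          (1 - s) ^ (m + 2) - s ≤ G.indepVal (S.erase v) s ∧ 0 < (1 - s) ^ (m + 2) - s := by
        intro s hs hst
        have h3 : (1 - t) ^ (m + 2) ≤ (1 - s) ^ (m + 2) :=
          pow_le_pow_left₀ (by linarith) (by linarith) _
        have h4 : (1 - t) ^ (m + 1) * (1 - 2 * t) ≤ (1 - t) ^ (m + 2) := by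
          rw [pow_succ _ (m + 1)]
          exact mul_le_mul_of_nonneg_left (by linarith) (pow_nonneg (by linarith) _)
        have h5 : 0 < (1 - s) ^ (m + 2) - s := by linarith
        exact ⟨hvc.star_le_indepVal (by omega) (by omega) hs (by linarith) h5, h5⟩
      have hP : G.PosOn (S.erase v) t :=
        posOn_of_pos ht fun s hs hst => (key s hs hst).2.trans_le (key s hs hst).1
      have h5 := (hP.mono (sdiff_subset (t := G.nbrIn v S))).le_pow (by linarith)
      rw [show #(S.erase v \ G.nbrIn v S) = m + 1 by omega] at h5
      have h6 := (key t ht le_rfl).1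
      have h7 := mul_le_mul_of_nonneg_left h5 ht
      rw [indepVal_erase hv]
      rw [pow_succ _ (m + 1)] at h6
      linarith

lemma ConnOn.erase_of_card_nbrIn_eq_one {S : Finset V} (hc : G.ConnOn S) {v : V} (hv : v ∈ S)
    (hN : #(G.nbrIn v S) = 1) : G.ConnOn (S.erase v) := by
  obtain ⟨w, hw⟩ := card_eq_one.1 hN
  have hwv : ∀ a ∈ S, G.Adj v a → a = w := fun a ha h => by
    have : a ∈ G.nbrIn v S := by simp [ha, h]
    rw [hw, mem_singleton] at this
    exact this
  have hvw : G.Adj v w := by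
    have : w ∈ G.nbrIn v S := by simp [hw]
    exact (mem_nbrIn.1 this).2
  intro U hU hne
  have hvU : v ∉ U := fun h => notMem_erase v S (hU.1 h)
  by_cases hwU : w ∈ U
  · have h1 : G.ClosedIn (insert v U) S := by
      refine ⟨insert_subset hv (hU.1.trans (erase_subset _ _)), fun a ha b hb hab => ?_⟩
      by_cases hbv : b = v
      · subst hbv
        exact mem_insert_self _ _
      · rcases mem_insert.1 ha with rfl | ha
        · rw [hwv b hb hab]
          exact mem_insert_of_mem hwU
        · exact mem_insert_of_mem (hU.2 a ha b (mem_erase.2 ⟨hbv, hb⟩) hab)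
    rw [← hc _ h1 (insert_nonempty _ _), erase_insert hvU]
  · have h1 : G.ClosedIn U S := by
      refine ⟨hU.1.trans (erase_subset _ _), fun a ha b hb hab => ?_⟩
      by_cases hbv : b = v
      · subst hbv
        exact absurd (hwv a (erase_subset _ _ (hU.1 ha)) hab.symm ▸ ha) hwU
      · exact hU.2 a ha b (mem_erase.2 ⟨hbv, hb⟩) hab
    exact absurd (hc U h1 hne ▸ hv) hvU

lemma exists_pos_near_zero {f : ℝ → ℝ} (hf : Continuous f) (h0 : 0 < f 0) :
    ∃ δ > 0, ∀ t, 0 ≤ t → t ≤ δ → 0 < f t := by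
  obtain ⟨ε, hε, h⟩ := Metric.eventually_nhds_iff.1 (hf.continuousAt.eventually (lt_mem_nhds h0))
  refine ⟨ε / 2, by positivity, fun t ht htε => h ?_⟩
  rw [Real.dist_eq, sub_zero, abs_of_nonneg ht]
  linarith

lemma exists_posOn (S : Finset V) : ∃ δ > 0, ∀ t, 0 ≤ t → t ≤ δ → G.PosOn S t := by
  obtain ⟨δ, hδ, h⟩ := exists_pos_near_zero (continuous_indepVal (G := G) S)
    (by rw [indepVal_zero]; exact one_pos)
  exact ⟨δ, hδ, fun t ht htδ => posOn_of_pos ht fun s hs hst => h s hs (hst.trans htδ)⟩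

lemma polynomial_ext_of_eval_neg {p q : ℝ[X]} {δ : ℝ} (hδ : 0 < δ)
    (h : ∀ t, 0 ≤ t → t ≤ δ → p.eval (-t) = q.eval (-t)) : p = q := by
  refine eq_of_infinite_eval_eq p q ((Set.Icc_infinite (neg_lt_zero.2 hδ)).mono ?_)
  intro x hx
  have := h (-x) (by linarith [hx.2]) (by linarith [hx.1])
  rwa [neg_neg] at this

lemma two_mul_coeff_two_pow_mul (m : ℕ) :
    2 * ((1 + X : ℝ[X]) ^ m * (1 + C 2 * X)).coeff 2 = (m : ℝ) * (m - 1) + 4 * m := by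
  rw [show (1 + X : ℝ[X]) ^ m * (1 + C 2 * X) = (1 + X) ^ m + C 2 * (X * (1 + X) ^ m) by ring,
    coeff_add, coeff_C_mul, coeff_X_mul, coeff_one_add_X_pow, coeff_one_add_X_pow,
    Nat.cast_choose_two, Nat.choose_one_right]
  ring

/-- Equality in the bound for unicyclic graphs: the neighbour of a leaf is adjacent to all other
vertices. -/
theorem ConnOn.adj_of_indepPolyOn_eq {S : Finset V} (hc : G.ConnOn S) {m : ℕ}
    (hm : #S = m + 3) (hd : G.degSum S = 2 * #S)
    (hP : G.indepPolyOn S = (1 + X) ^ m * (1 + C 2 * X) + X) {v w : V} (hv : v ∈ S)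
    (hN : G.nbrIn v S = {w}) : ∀ a ∈ S, a ≠ w → G.Adj w a := by
  have hN1 : #(G.nbrIn v S) = 1 := by simp [hN]
  have hvc := hc.erase_of_card_nbrIn_eq_one hv hN1
  have hcard := card_erase_add_one hv
  have hds := degSum_erase (G := G) hv
  have hc' := card_erase_sdiff_nbrIn (G := G) hv
  have hwv : w ∈ G.nbrIn v S := by simp [hN]
  have hw : w ∈ S.erase v := by
    rw [← nbrIn_erase_self] at hwv
    exact nbrIn_subset _ _ hwv
  obtain ⟨a, ha, b, hb, hab⟩ := exists_adj_erase_sdiff hv (by omega) hd hN1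
  cases m with
  | zero =>
    have := degSum_le (G := G) (S.erase v)
    rw [show #(S.erase v) = 2 by omega] at this
    omega
  | succ m =>
    have hPoly : G.indepPolyOn (S.erase v \ G.nbrIn v S) = (1 + X) ^ m * (1 + C 2 * X) := by
      obtain ⟨δ₁, hδ₁, h1⟩ := exists_posOn (G := G) (S.erase v)
      obtain ⟨δ₂, hδ₂, h2⟩ := exists_pos_near_zero
        (f := fun t : ℝ => (1 - t) ^ m * (1 - 2 * t) - t) (by fun_prop) (by simp)
      have hδ : 0 < min (min δ₁ δ₂) (1 / 2) := by positivity
      refine polynomial_ext_of_eval_neg hδ fun t ht htδ => ?_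
      have ht1 : t ≤ δ₁ := htδ.trans ((min_le_left _ _).trans (min_le_left _ _))
      have ht2 : t ≤ δ₂ := htδ.trans ((min_le_left _ _).trans (min_le_right _ _))
      have ht3 : t ≤ 1 / 2 := htδ.trans (min_le_right _ _)
      have h3 := ((h1 t ht ht1).mono (sdiff_subset (t := G.nbrIn v S))).le_of_adj
        (by linarith) ha hb hab (m := m) (by omega)
      have h4 := hvc.indepVal_ge_of_unicyclic (m := m) (by omega) (by omega) ht (by linarith)
        (h2 t ht ht2)
      have h5 := indepVal_erase (G := G) hv t
      have h6 : G.indepVal S t = (1 - t) ^ (m + 1) * (1 - 2 * t) - t := by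
        rw [indepVal, hP]
        simp only [eval_add, eval_mul, eval_pow, eval_one, eval_X, eval_C]
        ring
      change G.indepVal (S.erase v \ G.nbrIn v S) t = _
      simp only [eval_add, eval_mul, eval_pow, eval_one, eval_X, eval_C]
      -- The lower bound for I(S - v), together with the known I(S), forces equality with the upper
      -- bound `h3` near zero.
      have h7 : t * ((1 - t) ^ m * (1 - 2 * t)) ≤
          t * G.indepVal (S.erase v \ G.nbrIn v S) t := by
        rw [h6, pow_succ] at h5
        linarith
      rcases ht.eq_or_lt with rfl | ht0
      · simp [indepVal_zero]
      · have h8 := le_of_mul_le_mul_left h7 ht0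
        rw [le_antisymm h3 h8]
        ring
    -- Counting edges: only one survives the removal of `v` and `w`, so `w` is adjacent to all of S
    -- - v.
    have hco := (two_mul_coeff_two_indepPolyOn (G := G) (S.erase v \ G.nbrIn v S)).2.2
    rw [hPoly, two_mul_coeff_two_pow_mul,
      show #(S.erase v \ G.nbrIn v S) = m + 2 by omega] at hco
    have hdeg : G.degSum (S.erase v \ G.nbrIn v S) = 2 := by
      have : (G.degSum (S.erase v \ G.nbrIn v S) : ℝ) = 2 := by
        push_cast at hco
        linarith
      exact_mod_cast this
    rw [hN, sdiff_singleton_eq_erase] at hdeg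
    have hds2 := degSum_erase (G := G) hw
    have hsub : G.nbrIn w (S.erase v) ⊆ (S.erase v).erase w := by
      rw [← nbrIn_erase_self]
      exact nbrIn_subset _ _
    have heq := eq_of_subset_of_card_le hsub
      (by have := card_erase_add_one hw; omega)
    intro x hx hxw
    by_cases hxv : x = v
    · rw [hxv]
      exact (mem_nbrIn.1 hwv).2.symm
    · have : x ∈ G.nbrIn w (S.erase v) := by
        rw [heq]
        simp [hx, hxw, hxv]
      exact (mem_nbrIn.1 this).2

end Upper

/-! ### The smallest positive zero in t controls all complex roots. -/

section MinModulus

variable {V : Type*} [DecidableEq V] {G : SimpleGraph V} [DecidableRel G.Adj]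

lemma aeval_indepPolyOn_erase {S : Finset V} {v : V} (hv : v ∈ S) (z : ℂ) :
    aeval z (G.indepPolyOn S) = aeval z (G.indepPolyOn (S.erase v)) +
      z * aeval z (G.indepPolyOn (S.erase v \ G.nbrIn v S)) := by
  rw [indepPolyOn_erase hv]
  simp

/-- Ratios of independence polynomials at a complex number `z` are bounded below by those at
`-t`, if `‖z‖ ≤ t` and `-t` is closer to `0` than the largest negative root. -/
theorem PosOn.indepVal_mul_norm_le {S U : Finset V} {t : ℝ} (h : G.PosOn S t) (hU : U ⊆ S)
    {z : ℂ} (hz : ‖z‖ ≤ t) :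
    G.indepVal S t * ‖aeval z (G.indepPolyOn U)‖ ≤
      ‖aeval z (G.indepPolyOn S)‖ * G.indepVal U t := by
  induction S using Finset.strongInduction generalizing U with
  | H S ih =>
    rcases hU.eq_or_ssubset with rfl | hlt
    · rw [mul_comm]
    · obtain ⟨v, hv, hvU⟩ := exists_of_ssubset hlt
      have hS' := h.mono (erase_subset v S)
      have h1 := ih _ (erase_ssubset hv) hS' (subset_erase.2 ⟨hU, hvU⟩)
      have h2 := ih _ (erase_ssubset hv) hS' (sdiff_subset (t := G.nbrIn v S))
      have hp := hS'.pos
      have hstep : G.indepVal S t * ‖aeval z (G.indepPolyOn (S.erase v))‖ ≤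
          ‖aeval z (G.indepPolyOn S)‖ * G.indepVal (S.erase v) t := by
        -- The deletion formula at z, with the reverse triangle inequality and `‖z‖ ≤ t`; the
        -- induction hypothesis then bounds the subtracted term.
        have h3 : ‖aeval z (G.indepPolyOn (S.erase v))‖ -
            t * ‖aeval z (G.indepPolyOn (S.erase v \ G.nbrIn v S))‖ ≤
            ‖aeval z (G.indepPolyOn S)‖ := by
          rw [aeval_indepPolyOn_erase hv]
          have h4 := norm_sub_le_norm_add (aeval z (G.indepPolyOn (S.erase v)))
            (z * aeval z (G.indepPolyOn (S.erase v \ G.nbrIn v S)))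
          rw [norm_mul] at h4
          have h5 := mul_le_mul_of_nonneg_right hz
            (norm_nonneg (aeval z (G.indepPolyOn (S.erase v \ G.nbrIn v S))))
          linarith
        have h6 := mul_le_mul_of_nonneg_right h3 hp.le
        have h7 := mul_le_mul_of_nonneg_left h2 h.1
        rw [indepVal_erase hv]
        linarith
      have h8 := mul_le_mul_of_nonneg_left h1 h.pos.le
      have h9 := mul_le_mul_of_nonneg_right hstep (h.mono hU).pos.le
      refine le_of_mul_le_mul_right ?_ hp
      linarith

lemma PosOn.aeval_ne_zero {S : Finset V} {t : ℝ} (h : G.PosOn S t) {z : ℂ} (hz : ‖z‖ ≤ t) :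
    aeval z (G.indepPolyOn S) ≠ 0 := by
  intro h0
  have h1 := h.indepVal_mul_norm_le (empty_subset S) hz
  rw [h0, indepPolyOn_empty, indepVal_empty, map_one, norm_one, norm_zero] at h1
  have := h.pos
  linarith

/-- Positivity on all of [0, 1] would pass to a single vertex, whose value 1 - t vanishes at 1. -/
lemma exists_first_root {S : Finset V} (hS : S.Nonempty) :
    ∃ r, 0 < r ∧ G.indepVal S r = 0 ∧ ∀ x, 0 ≤ x → x < r → 0 < G.indepVal S x := by
  obtain ⟨v, hv⟩ := hS
  obtain ⟨s, hs0, -, hs⟩ : ∃ s : ℝ, 0 ≤ s ∧ s ≤ 1 ∧ G.indepVal S s ≤ 0 := by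
    by_contra hcon
    push Not at hcon
    have h1 := (posOn_of_pos zero_le_one hcon).2 {v} (singleton_subset_iff.2 hv)
    rw [indepVal_singleton] at h1
    linarith
  obtain ⟨r, hr, -, h1, h2⟩ := exists_first_zero (continuous_indepVal S)
    (by rw [indepVal_zero]; exact one_pos) hs0 hs
  exact ⟨r, hr, h1, h2⟩

end MinModulus

/-! ### From whole graphs to induced subgraphs; recognition of C_n and U_n. -/

section Bridge

variable {V : Type*} [Fintype V] [DecidableEq V] {G : SimpleGraph V} [DecidableRel G.Adj]

lemma indepPoly_eq_indepPolyOn : G.indepPoly = G.indepPolyOn univ := by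
  classical
  unfold indepPoly indepPolyOn
  rw [← sum_filter, powerset_univ, ← sum_fiberwise_of_maps_to (g := card)
    (t := range (G.indepNum + 1))]
  · refine sum_congr rfl fun k _ => ?_
    have h : G.indepSetSet k =
        (((univ : Finset (Finset V)).filter fun T : Finset V => G.IsIndepSet (T : Set V)).filter
          fun T : Finset V => #T = k : Finset (Finset V)) := by
      ext T
      simp [mem_indepSetSet_iff, isNIndepSet_iff]
    rw [h, Set.ncard_coe_finset, sum_congr rfl (g := fun _ => X ^ k)
      (fun T hT => by rw [(mem_filter.1 hT).2]), sum_const, nsmul_eq_mul, C_eq_natCast]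
  · intro T hT
    rw [mem_range, Nat.lt_succ_iff]
    exact IsIndepSet.card_le_indepNum (mem_filter.1 hT).2

lemma Connected.connOn_univ (h : G.Connected) : G.ConnOn univ := by
  rintro U hU ⟨x, hx⟩
  refine eq_univ_of_forall fun y => ?_
  obtain ⟨p⟩ := h.preconnected x y
  clear h
  induction p with
  | nil => exact hx
  | cons hab _ ih => exact ih (hU.2 _ hx _ (mem_univ _) hab)

lemma nbrIn_univ (v : V) : G.nbrIn v univ = G.neighborFinset v := by
  ext a
  simp

/-- A connected unicyclic graph has as many edges as vertices. -/
lemma IsUnicyclic.degSum_univ (hc : G.Connected) (h : G.IsUnicyclic) :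
    G.degSum univ = 2 * #(univ : Finset V) := by
  classical
  obtain ⟨C, ⟨u, p, hp, hpC⟩, huniq⟩ := h
  obtain ⟨e, he⟩ : ∃ e, e ∈ p.edges := by
    refine List.exists_mem_of_ne_nil _ fun h0 => ?_
    have := hp.three_le_length
    rw [← Walk.length_edges, h0] at this
    simp at this
  have heG : e ∈ G.edgeSet := p.edges_subset_edgeSet he
  -- An edge on a cycle is not a bridge, and any cycle avoiding `e` would have to be the unique one,
  -- which contains `e`.
  have hT : (G.deleteEdges {e}).IsTree := by
    refine ⟨?_, ?_⟩
    · induction e with | h x y =>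
      refine hc.connected_delete_edge_of_not_isBridge ?_
      intro hb
      exact (isBridge_iff_forall_cycle_notMem heG).1 hb p hp he
    · intro v q hq
      have hle : G.deleteEdges {e} ≤ G := deleteEdges_le _
      have h1 := huniq (q.mapLe hle).toSubgraph ⟨v, q.mapLe hle, hq.mapLe hle, rfl⟩
      have h2 : e ∈ C.edgeSet := by
        rw [← hpC, Walk.mem_edges_toSubgraph]
        exact he
      rw [← h1, Walk.mem_edges_toSubgraph] at h2
      have h3 : e ∈ q.edges := by simpa using h2
      have h4 := q.edges_subset_edgeSet h3
      simp at h4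
  have h1 := hT.card_edgeFinset
  have h2 : (G.deleteEdges {e}).edgeFinset = G.edgeFinset.erase e := by
    ext x
    simp only [mem_edgeFinset, edgeSet_deleteEdges, Set.mem_sdiff, Set.mem_singleton_iff, mem_erase]
    tauto
  have h3 := card_erase_add_one (mem_edgeFinset.2 heG)
  rw [h2] at h1
  have h4 := G.sum_degrees_eq_twice_card_edges
  have h5 : G.degSum univ = ∑ v, G.degree v := sum_congr rfl fun v _ => by
    rw [nbrIn_univ, card_neighborFinset_eq_degree]
  rw [h5, h4, card_univ]
  omega

/-- Connectedness and 2-regularity give a spanning cycle, hence a bijective copy of the cycle graph;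
equal degrees leave no room for extra edges. -/
lemma nonempty_iso_cycleGraph (hc : G.Connected) (hcard : 3 ≤ Fintype.card V)
    (hreg : ∀ v, #(G.nbrIn v univ) = 2) :
    Nonempty (G ≃g cycleGraph (Fintype.card V)) := by
  classical
  have hcyc : G.IsCycles := by
    intro v _
    rw [← hreg v, nbrIn_univ, ← Set.ncard_coe_finset, coe_neighborFinset]
  obtain ⟨x⟩ := hc.nonempty
  obtain ⟨p, hp, hpv⟩ := hcyc.exists_cycle_toSubgraph_verts_eq_connectedComponentSupp
    (c := G.connectedComponentMk x) (v := x) rfl (by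
      have h1 : 0 < #(G.nbrIn x univ) := by rw [hreg]; norm_num
      obtain ⟨y, hy⟩ := card_pos.1 h1
      exact ⟨y, (mem_nbrIn.1 hy).2⟩)
  have hverts : ∀ y, y ∈ p.support := by
    intro y
    rw [← Walk.mem_verts_toSubgraph, hpv, ConnectedComponent.mem_supp_iff,
      ConnectedComponent.eq]
    exact hc.preconnected y x
  have hlen : p.length = Fintype.card V := by
    have h1 : p.support.tail.toFinset = univ := by
      refine eq_univ_of_forall fun y => ?_
      rw [List.mem_toFinset]
      rcases (Walk.mem_support_iff p).1 (hverts y) with rfl | h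
      · exact Walk.end_mem_tail_support hp.not_nil
      · exact h
    have h2 := List.toFinset_card_of_nodup hp.support_nodup
    rw [h1, card_univ, List.length_tail, Walk.length_support] at h2
    omega
  obtain ⟨f⟩ := (cycleGraph_isContained_iff (by omega)).2 ⟨x, p, hp, hlen⟩
  have hinj : Function.Injective f := f.injective
  have hbij : Function.Bijective f :=
    (Fintype.bijective_iff_injective_and_card f).2 ⟨hinj, by simp⟩
  refine ⟨RelIso.symm ⟨Equiv.ofBijective f hbij, ?_⟩⟩
  intro i j
  change G.Adj (f i) (f j) ↔ _
  refine ⟨fun h => ?_, fun h => f.toHom.map_adj h⟩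
  obtain ⟨m, hm⟩ := Nat.exists_eq_add_of_le' hcard
  have hdeg : #((cycleGraph (Fintype.card V)).neighborFinset i) = 2 := by
    have : ∀ k, k = m + 3 → ∀ i : Fin k, #((cycleGraph k).neighborFinset i) = 2 := by
      rintro k rfl i
      rw [card_neighborFinset_eq_degree, cycleGraph_degree_three_le]
    exact this _ hm i
  have hsub : ((cycleGraph (Fintype.card V)).neighborFinset i).image f ⊆
      G.nbrIn (f i) univ := by
    intro y hy
    obtain ⟨k, hk, rfl⟩ := mem_image.1 hy
    rw [mem_neighborFinset] at hk
    exact mem_nbrIn.2 ⟨mem_univ _, f.toHom.map_adj hk⟩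
  have heq := eq_of_subset_of_card_le hsub
    (by rw [hreg, card_image_of_injective _ hinj, hdeg])
  have hj : f j ∈ G.nbrIn (f i) univ := mem_nbrIn.2 ⟨mem_univ _, h⟩
  rw [← heq] at hj
  obtain ⟨k, hk, hkj⟩ := mem_image.1 hj
  rw [hinj hkj, mem_neighborFinset] at hk
  exact hk

/-- Removing the dominating vertex leaves degree sum 2, hence a single edge ab. Sending 0, 1, 2 to
w, a, b and extending to any bijection is an isomorphism. -/
lemma nonempty_iso_graphU (hcard : 3 ≤ Fintype.card V) (hd : G.degSum univ = 2 * Fintype.card V)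
    {w : V} (hw : ∀ a, a ≠ w → G.Adj w a) :
    Nonempty (G ≃g graphU (Fintype.card V)) := by
  have hds := degSum_erase (G := G) (mem_univ w)
  have hN : G.nbrIn w univ = univ.erase w := by
    ext a
    simp only [mem_nbrIn, mem_univ, true_and, mem_erase, and_true]
    exact ⟨fun h => h.ne', hw a⟩
  have hce := card_erase_add_one (mem_univ w)
  rw [card_univ] at hce
  rw [hN] at hds
  have hd2 : G.degSum (univ.erase w) = 2 := by omega
  obtain ⟨a, ha, b, hb, hab⟩ := exists_adj_of_degSum_pos (by omega : 0 < G.degSum (univ.erase w))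
  have hds2 := degSum_erase (G := G) ha
  have hba : b ∈ G.nbrIn a (univ.erase w) := mem_nbrIn.2 ⟨hb, hab⟩
  have hpos := card_pos.2 ⟨b, hba⟩
  obtain ⟨b', hb'⟩ := card_eq_one.1 (by omega : #(G.nbrIn a (univ.erase w)) = 1)
  have hbb : b = b' := by simpa [hb'] using hba
  subst hbb
  have haw : a ≠ w := (mem_erase.1 ha).1
  have hbw : b ≠ w := (mem_erase.1 hb).1
  have hab' : ∀ x, x ≠ w → G.Adj a x → x = b := fun x hx h => by
    have : x ∈ G.nbrIn a (univ.erase w) := by simp [hx, h]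
    rwa [hb', mem_singleton] at this
  have hother : ∀ x y, x ≠ w → y ≠ w → x ≠ a → y ≠ a → ¬ G.Adj x y := by
    intro x y hx hy hxa hya hxy
    have h0 : G.degSum ((univ.erase w).erase a) = 0 := by omega
    have h1 := (sum_eq_zero_iff.1 h0) x (by simp [hx, hxa])
    rw [card_eq_zero] at h1
    have : y ∈ G.nbrIn x ((univ.erase w).erase a) := by simp [hy, hya, hxy]
    rw [h1] at this
    exact notMem_empty _ this
  set n := Fintype.card V with hn
  let i₀ : Fin n := ⟨0, by omega⟩
  let i₁ : Fin n := ⟨1, by omega⟩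
  let i₂ : Fin n := ⟨2, by omega⟩
  let f : Fin n → V := fun i => if i = i₀ then w else if i = i₁ then a else b
  have h01 : i₁ ≠ i₀ := by simp [i₀, i₁]
  have h02 : i₂ ≠ i₀ := by simp [i₀, i₂]
  have h12 : i₂ ≠ i₁ := by simp [i₁, i₂]
  have f0 : f i₀ = w := by simp [f]
  have f1 : f i₁ = a := by simp [f, h01]
  have f2 : f i₂ = b := by simp [f, h02, h12]
  obtain ⟨g, hg⟩ := Finset.exists_equiv_extend_of_card_eq (α := Fin n) (t := (univ : Finset V))
    (by simp [hn]) (s := {i₀, i₁, i₂}) (f := f) (subset_univ _) (by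
      intro x hx y hy hxy
      simp only [coe_insert, coe_singleton, Set.mem_insert_iff, Set.mem_singleton_iff] at hx hy
      rcases hx with rfl | rfl | rfl <;> rcases hy with rfl | rfl | rfl <;>
        simp only [f0, f1, f2] at hxy <;> first | rfl | skip
      · exact absurd hxy.symm haw
      · exact absurd hxy.symm hbw
      · exact absurd hxy haw
      · exact absurd hxy hab.ne
      · exact absurd hxy hbw
      · exact absurd hxy.symm hab.ne)
  have g0 : (g i₀ : V) = w := by rw [hg _ (by simp), f0]
  have g1 : (g i₁ : V) = a := by rw [hg _ (by simp), f1]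
  have g2 : (g i₂ : V) = b := by rw [hg _ (by simp), f2]
  let e : Fin n ≃ V := g.trans (Equiv.subtypeUnivEquiv fun x => mem_univ x)
  have e0 : e i₀ = w := g0
  have e1 : e i₁ = a := g1
  have e2 : e i₂ = b := g2
  have e0' : ∀ i, e i = w ↔ i.val = 0 := fun i => by
    rw [← e0, e.apply_eq_iff_eq, Fin.ext_iff]
  have e1' : ∀ i, e i = a ↔ i.val = 1 := fun i => by
    rw [← e1, e.apply_eq_iff_eq, Fin.ext_iff]
  have e2' : ∀ i, e i = b ↔ i.val = 2 := fun i => by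
    rw [← e2, e.apply_eq_iff_eq, Fin.ext_iff]
  have hadj : ∀ x y, G.Adj x y ↔
      x ≠ y ∧ ((x = w ∨ (x = a ∧ y = b)) ∨ (y = w ∨ (y = a ∧ x = b))) := by
    intro x y
    constructor
    · intro h
      refine ⟨h.ne, ?_⟩
      by_cases hx : x = w
      · exact Or.inl (Or.inl hx)
      by_cases hy : y = w
      · exact Or.inr (Or.inl hy)
      by_cases hxa : x = a
      · exact Or.inl (Or.inr ⟨hxa, hab' y hy (hxa ▸ h)⟩)
      by_cases hya : y = a
      · exact Or.inr (Or.inr ⟨hya, hab' x hx (hya ▸ h.symm)⟩)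
      exact absurd h (hother x y hx hy hxa hya)
    · rintro ⟨hne, (rfl | ⟨rfl, rfl⟩) | (rfl | ⟨rfl, rfl⟩)⟩
      · exact hw _ hne.symm
      · exact hab
      · exact (hw _ hne).symm
      · exact hab.symm
  refine ⟨RelIso.symm ⟨e, ?_⟩⟩
  intro i j
  rw [hadj, e0', e0', e1', e1', e2', e2', e.injective.ne_iff, graphU, fromRel_adj]

end Bridge

/-! ### Explicit polynomials of paths, cycles and U_n. -/

section Values

variable {V : Type*} [DecidableEq V] {G : SimpleGraph V} [DecidableRel G.Adj]

/-- Paths are given by an enumeration so that both pieces left by deleting a vertex of a cycle are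
covered. -/
lemma indepPolyOn_path {k : ℕ} {φ : ℕ → V} (hinj : Set.InjOn φ (Set.Iio k))
    (hadj : ∀ i < k, ∀ j < k, G.Adj (φ i) (φ j) ↔ i + 1 = j ∨ j + 1 = i) :
    G.indepPolyOn ((range k).image φ) = pathSeq (-X) (k + 2) := by
  induction k using Nat.twoStepInduction with
  | zero => simp [indepPolyOn_empty, pathSeq]
  | one =>
    have h := indepPolyOn_insert (G := G) (notMem_empty (φ 0))
    rw [range_one, image_singleton, ← insert_empty_eq, h, indepPolyOn_empty, empty_sdiff,
      indepPolyOn_empty]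
    simp [pathSeq]
  | more k h1 h2 =>
    have hnot : φ (k + 1) ∉ (range (k + 1)).image φ := by
      rw [mem_image]
      rintro ⟨i, hi, he⟩
      rw [mem_range] at hi
      have := hinj (show i < k + 2 by omega) (show k + 1 < k + 2 by omega) he
      omega
    have hsd : (range (k + 1)).image φ \ G.nbrIn (φ (k + 1)) ((range (k + 1)).image φ) =
        (range k).image φ := by
      ext x
      simp only [mem_sdiff, mem_image, mem_range, mem_nbrIn]
      constructor
      · rintro ⟨⟨i, hi, rfl⟩, hn⟩
        refine ⟨i, ?_, rfl⟩
        by_contra hik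
        refine hn ⟨⟨i, hi, rfl⟩, (hadj _ (by omega) _ (by omega)).2 (by omega)⟩
      · rintro ⟨i, hi, rfl⟩
        refine ⟨⟨i, by omega, rfl⟩, fun h => ?_⟩
        have := (hadj _ (by omega) _ (by omega)).1 h.2
        omega
    rw [range_add_one, image_insert, indepPolyOn_insert hnot, hsd,
      h1 (hinj.mono fun i hi => by simp only [Set.mem_Iio] at hi ⊢; omega)
        (fun i hi j hj => hadj i (by omega) j (by omega)),
      h2 (hinj.mono fun i hi => by simp only [Set.mem_Iio] at hi ⊢; omega)
        (fun i hi j hj => hadj i (by omega) j (by omega)), pathSeq_add_two (k + 2)]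
    ring

lemma indepPolyOn_cycleGraph (m : ℕ) :
    (cycleGraph (m + 3)).indepPolyOn univ = cycleSeq (-X) (m + 3) := by
  have hval : ∀ i, i < m + 3 → (Fin.ofNat (m + 3) i).val = i := fun i hi => by
    simp [Fin.ofNat, Nat.mod_eq_of_lt hi]
  have hadj : ∀ i < m + 3, ∀ j < m + 3,
      (cycleGraph (m + 3)).Adj (Fin.ofNat (m + 3) i) (Fin.ofNat (m + 3) j) ↔
        i + 1 = j ∨ j + 1 = i ∨ (i = 0 ∧ j = m + 2) ∨ (j = 0 ∧ i = m + 2) := by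
    intro i hi j hj
    rw [cycleGraph_adj', Fin.sub_def, Fin.sub_def]
    simp only [hval i hi, hval j hj]
    rcases Nat.lt_or_ge i j with h | h
    · rw [show m + 3 - i + j = (j - i) + (m + 3) by omega, Nat.add_mod_right,
        Nat.mod_eq_of_lt (by omega : j - i < m + 3),
        Nat.mod_eq_of_lt (by omega : m + 3 - j + i < m + 3)]
      omega
    · rcases h.eq_or_lt with rfl | h
      · rw [Nat.sub_add_cancel hi.le, Nat.mod_self]
        omega
      · rw [show m + 3 - j + i = (i - j) + (m + 3) by omega, Nat.add_mod_right,
          Nat.mod_eq_of_lt (by omega : i - j < m + 3),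
          Nat.mod_eq_of_lt (by omega : m + 3 - i + j < m + 3)]
        omega
  have hinj : Set.InjOn (Fin.ofNat (m + 3)) (Set.Iio (m + 3)) := by
    intro i hi j hj h
    have := congrArg Fin.val h
    rwa [hval i hi, hval j hj] at this
  have hE : (univ : Finset (Fin (m + 3))).erase (Fin.ofNat (m + 3) (m + 2)) =
      (range (m + 2)).image (Fin.ofNat (m + 3)) := by
    ext x
    simp only [mem_erase, mem_univ, and_true, mem_image, mem_range]
    constructor
    · intro h
      refine ⟨x.val, ?_, Fin.ext (hval _ x.2)⟩
      have h1 := x.2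
      by_contra h2
      exact h (Fin.ext (by rw [hval _ (by omega)]; omega))
    · rintro ⟨i, hi, rfl⟩ h
      have := hinj (show i < m + 3 by omega) (show m + 2 < m + 3 by omega) h
      omega
  have hN : (univ : Finset (Fin (m + 3))).erase (Fin.ofNat (m + 3) (m + 2)) \
      (cycleGraph (m + 3)).nbrIn (Fin.ofNat (m + 3) (m + 2)) univ =
      (range m).image fun i => Fin.ofNat (m + 3) (i + 1) := by
    rw [hE]
    ext x
    simp only [mem_sdiff, mem_image, mem_range, mem_nbrIn, mem_univ, true_and]
    constructor
    · rintro ⟨⟨i, hi, rfl⟩, hn⟩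
      rw [hadj _ (by omega) _ (by omega)] at hn
      exact ⟨i - 1, by omega, by rw [show i - 1 + 1 = i by omega]⟩
    · rintro ⟨i, hi, rfl⟩
      refine ⟨⟨i + 1, by omega, rfl⟩, ?_⟩
      rw [hadj _ (by omega) _ (by omega)]
      omega
  rw [indepPolyOn_erase (mem_univ (Fin.ofNat (m + 3) (m + 2))), hN, hE,
    indepPolyOn_path (hinj.mono fun i hi => by simp only [Set.mem_Iio] at hi ⊢; omega)
      (fun i hi j hj => by rw [hadj _ (by omega) _ (by omega)]; omega),
    indepPolyOn_path
      (fun i hi j hj h => by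
        simp only [Set.mem_Iio] at hi hj
        have := hinj (show i + 1 < m + 3 by omega) (show j + 1 < m + 3 by omega) h
        omega)
      (fun i hi j hj => by rw [hadj _ (by omega) _ (by omega)]; omega),
    cycleSeq_succ (m + 2)]
  ring

lemma indepPolyOn_of_single_edge {S : Finset V} {a b : V} (ha : a ∈ S) (hb : b ∈ S)
    (hab : G.Adj a b)
    (hother : ∀ x ∈ S, ∀ y ∈ S, G.Adj x y → (x = a ∧ y = b) ∨ (x = b ∧ y = a))
    {m : ℕ} (hm : #S = m + 2) : G.indepPolyOn S = (1 + X) ^ m * (1 + C 2 * X) := by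
  have hsub : ({a, b} : Finset V) ⊆ S := by
    simp [insert_subset_iff, ha, hb]
  have hc2 : #({a, b} : Finset V) = 2 := card_pair hab.ne
  induction m generalizing S with
  | zero =>
    have hS := eq_of_subset_of_card_le hsub (by omega)
    have hn : ({b} : Finset V) \ G.nbrIn a {b} = ∅ := by
      ext x
      simp only [mem_sdiff, mem_singleton, mem_nbrIn, notMem_empty, iff_false]
      rintro ⟨rfl, h⟩
      exact h ⟨rfl, hab⟩
    rw [← hS, indepPolyOn_insert (by simpa using hab.ne), hn, ← insert_empty_eq b,
      indepPolyOn_insert (notMem_empty b), empty_sdiff, indepPolyOn_empty, pow_zero, one_mul,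
      C_ofNat]
    ring
  | succ m ih =>
    obtain ⟨v, hv, hvab⟩ := exists_mem_notMem_of_card_lt_card (by omega : #({a, b} : Finset V) < #S)
    have hsub' : ({a, b} : Finset V) ⊆ S.erase v := subset_erase.2 ⟨hsub, hvab⟩
    have h1 := ih (hsub' (by simp)) (hsub' (by simp))
      (fun x hx y hy => hother x (erase_subset _ _ hx) y (erase_subset _ _ hy))
      (by have := card_erase_add_one hv; omega) hsub'
    have h2 : G.nbrIn v S = ∅ := by
      ext x
      simp only [mem_nbrIn, notMem_empty, iff_false, not_and]
      intro hx hvx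
      rcases hother v hv x hx hvx with ⟨rfl, -⟩ | ⟨rfl, -⟩ <;> simp at hvab
    rw [indepPolyOn_erase hv, h2, sdiff_empty, h1, pow_succ]
    ring

instance (n : ℕ) : DecidableRel (graphU n).Adj := by
  unfold graphU
  infer_instance

/-- Deleting the centre 0 leaves one edge and m isolated vertices; the only independent set
containing 0 is the singleton, which gives X. -/
lemma indepPolyOn_graphU (m : ℕ) :
    (graphU (m + 3)).indepPolyOn univ = (1 + X) ^ m * (1 + C 2 * X) + X := by
  have hadj : ∀ i j : Fin (m + 3), (graphU (m + 3)).Adj i j ↔ i ≠ j ∧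
      ((i.val = 0 ∨ (i.val = 1 ∧ j.val = 2)) ∨ (j.val = 0 ∨ (j.val = 1 ∧ i.val = 2))) :=
    fun i j => by rw [graphU, fromRel_adj]
  have hN : (univ : Finset (Fin (m + 3))).erase 0 \ (graphU (m + 3)).nbrIn 0 univ = ∅ := by
    ext x
    simp only [mem_sdiff, mem_erase, mem_univ, and_true, mem_nbrIn, true_and, notMem_empty,
      iff_false, not_and, not_not]
    intro hx
    rw [hadj]
    exact ⟨hx.symm, Or.inl (Or.inl rfl)⟩
  have hz : ∀ x : Fin (m + 3), x ∈ (univ : Finset (Fin (m + 3))).erase 0 → x.val ≠ 0 := by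
    intro x hx h
    exact (mem_erase.1 hx).1 (Fin.ext h)
  rw [indepPolyOn_erase (mem_univ 0), hN, indepPolyOn_empty, mul_one,
    indepPolyOn_of_single_edge (a := (⟨1, by omega⟩ : Fin (m + 3))) (b := ⟨2, by omega⟩)
      (m := m)]
  · simp
  · simp [Fin.ext_iff]
  · rw [hadj]
    simp
  · intro x hx y hy h
    have h1 := hz x hx
    have h2 := hz y hy
    rw [hadj] at h
    simp only [Fin.ext_iff]
    omega
  · rw [card_erase_of_mem (mem_univ _), card_univ, Fintype.card_fin]
    omega

end Values

/-! ### Equality with the polynomial of C_n. -/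

section CycleEquality

variable {V : Type*} [DecidableEq V] {G : SimpleGraph V} [DecidableRel G.Adj]

/-- The subgraph induced on `S` is a triangle with a pendant path attached at one vertex. -/
def IsTadpoleOn (G : SimpleGraph V) (S : Finset V) : Prop :=
  ∃ φ : ℕ → V, S = (range #S).image φ ∧ ∀ i < #S, ∀ j < #S,
    (G.Adj (φ i) (φ j) ↔ i + 1 = j ∨ j + 1 = i ∨ (i = 0 ∧ j = 2) ∨ (i = 2 ∧ j = 0))

lemma coeff_cycleSeq (n : ℕ) :
    (cycleSeq (-X : ℝ[X]) (n + 2)).coeff 0 = 1 ∧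
      (cycleSeq (-X : ℝ[X]) (n + 2)).coeff 1 = n + 2 := by
  have hrec : ∀ k, cycleSeq (-X : ℝ[X]) (k + 2) =
      cycleSeq (-X : ℝ[X]) (k + 1) + X * cycleSeq (-X : ℝ[X]) k := fun k => by
    rw [cycleSeq_add_two]
    ring
  induction n using Nat.twoStepInduction with
  | zero => simp [cycleSeq, coeff_one]
  | one => simp [cycleSeq, coeff_one]; norm_num
  | more n h1 h2 =>
    rw [hrec (n + 2), coeff_add, coeff_add, coeff_X_mul, show n + 2 + 1 = n + 1 + 2 by ring,
      h2.1, h2.2, h1.1]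
    refine ⟨by simp, ?_⟩
    push_cast
    ring

lemma two_mul_coeff_two_cycleSeq (n : ℕ) :
    2 * (cycleSeq (-X : ℝ[X]) (n + 3)).coeff 2 = ((n : ℝ) + 3) * n := by
  induction n with
  | zero => simp [cycleSeq, coeff_one, coeff_X]
  | succ n ih =>
    rw [show n + 1 + 3 = n + 2 + 2 by ring, cycleSeq_add_two,
      show cycleSeq (-X : ℝ[X]) (n + 2 + 1) - -X * cycleSeq (-X : ℝ[X]) (n + 2) =
        cycleSeq (-X : ℝ[X]) (n + 3) + X * cycleSeq (-X : ℝ[X]) (n + 2) by ring,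
      coeff_add, coeff_X_mul, mul_add, ih, (coeff_cycleSeq n).2]
    push_cast
    ring

lemma eval_cycleSeq (t : ℝ) (n : ℕ) :
    (cycleSeq (-X : ℝ[X]) n).eval (-t) = cycleSeq t n := by
  have h := map_cycleSeq (evalRingHom (-t)) (-X : ℝ[X]) n
  simpa using h

lemma isTadpoleOn_of_triangle {S : Finset V} {v w : V} (hv : v ∈ S) (hS : #S = 4)
    (hd : G.degSum S = 2 * #S) (hN : G.nbrIn v S = {w}) : G.IsTadpoleOn S := by
  have hds := degSum_erase (G := G) hv
  have hcard := card_erase_add_one hv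
  have hwv : w ∈ G.nbrIn v S := by simp [hN]
  have hvw := (mem_nbrIn.1 hwv).2
  have hw : w ∈ S.erase v := by
    rw [← nbrIn_erase_self] at hwv
    exact nbrIn_subset _ _ hwv
  rw [hN, card_singleton] at hds
  have hds2 := degSum_erase (G := G) hw
  have hcard2 := card_erase_add_one hw
  have h1 := degSum_le (G := G) ((S.erase v).erase w)
  rw [show #((S.erase v).erase w) = 2 by omega] at h1
  have h2 := card_nbrIn_lt (G := G) hw
  obtain ⟨a, ha, b, hb, hab⟩ :=
    exists_adj_of_degSum_pos (by omega : 0 < G.degSum ((S.erase v).erase w))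
  have hsub : G.nbrIn w (S.erase v) ⊆ (S.erase v).erase w := by
    rw [← nbrIn_erase_self]
    exact nbrIn_subset _ _
  have heq := eq_of_subset_of_card_le hsub (by omega)
  have hwa : G.Adj w a := by
    rw [← heq] at ha
    exact (mem_nbrIn.1 ha).2
  have hwb : G.Adj w b := by
    rw [← heq] at hb
    exact (mem_nbrIn.1 hb).2
  have hva : ∀ x ∈ (S.erase v).erase w, ¬ G.Adj v x := by
    intro x hx hvx
    simp only [mem_erase] at hx
    have : x ∈ G.nbrIn v S := mem_nbrIn.2 ⟨hx.2.2, hvx⟩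
    rw [hN, mem_singleton] at this
    exact hx.1 this
  have h3 := hva a ha
  have h4 := hva b hb
  have h3' : ¬ G.Adj a v := fun h => h3 h.symm
  have h4' : ¬ G.Adj b v := fun h => h4 h.symm
  have hab2 : ({a, b} : Finset V) = (S.erase v).erase w :=
    eq_of_subset_of_card_le (by simp only [insert_subset_iff, singleton_subset_iff]; exact ⟨ha, hb⟩)
      (by rw [card_pair hab.ne]; omega)
  refine ⟨fun i => if i = 0 then a else if i = 1 then b else if i = 2 then w else v, ?_, ?_⟩
  · rw [hS, ← insert_erase hv, ← insert_erase hw, ← hab2]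
    ext x
    simp only [mem_insert, mem_singleton, mem_image, mem_range]
    constructor
    · rintro (rfl | rfl | rfl | rfl)
      · exact ⟨3, by simp⟩
      · exact ⟨2, by simp⟩
      · exact ⟨0, by simp⟩
      · exact ⟨1, by simp⟩
    · rintro ⟨i, hi, rfl⟩
      interval_cases i <;> simp
  · intro i hi j hj
    rw [hS] at hi hj
    interval_cases i <;> interval_cases j <;>
      simp [hab, hab.symm, hwa, hwa.symm, hwb, hwb.symm, hvw, hvw.symm, h3, h4,
        h3', h4']

/-- In a tadpole on at least four vertices only the last vertex of the tail has degree 1, so `w` is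
that vertex and `v` prolongs the tail. -/
lemma IsTadpoleOn.of_erase {S : Finset V} {v w : V} (hv : v ∈ S) (hS : 5 ≤ #S)
    (hN : G.nbrIn v S = {w}) (h : G.IsTadpoleOn (S.erase v))
    (hw : #(G.nbrIn w (S.erase v)) = 1) : G.IsTadpoleOn S := by
  obtain ⟨φ, hφ, hadj⟩ := h
  have hcard := card_erase_add_one hv
  set s := #(S.erase v) with hs
  have hwv : w ∈ G.nbrIn v S := by simp [hN]
  have hvw := (mem_nbrIn.1 hwv).2
  have hwS : w ∈ S.erase v := by
    rw [← nbrIn_erase_self] at hwv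
    exact nbrIn_subset _ _ hwv
  have hinj : Set.InjOn φ (range s) := by
    rw [← card_image_iff, ← hφ, card_range, hs]
  have hmem : ∀ i < s, φ i ∈ S.erase v := fun i hi => by
    rw [hφ]
    exact mem_image_of_mem φ (mem_range.2 hi)
  obtain ⟨i, hi, hiw⟩ : ∃ i < s, φ i = w := by
    rw [hφ, mem_image] at hwS
    obtain ⟨i, hi, h⟩ := hwS
    exact ⟨i, mem_range.1 hi, h⟩
  have htwo : ∀ j < s, ∀ k < s, j ≠ k → G.Adj w (φ j) → G.Adj w (φ k) → False := by
    intro j hj k hk hjk haj hak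
    obtain ⟨x, hx⟩ := card_eq_one.1 hw
    have h1 : φ j ∈ G.nbrIn w (S.erase v) := mem_nbrIn.2 ⟨hmem j hj, haj⟩
    have h2 : φ k ∈ G.nbrIn w (S.erase v) := mem_nbrIn.2 ⟨hmem k hk, hak⟩
    rw [hx, mem_singleton] at h1 h2
    exact hjk (hinj (by simpa using hj) (by simpa using hk) (h1.trans h2.symm))
  have hlast : i + 1 = s := by
    by_contra hne
    subst hiw
    rcases Nat.eq_zero_or_pos i with rfl | h0
    · exact htwo 1 (by omega) 2 (by omega) (by omega)
        ((hadj _ hi _ (by omega)).2 (by omega)) ((hadj _ hi _ (by omega)).2 (by omega))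
    · exact htwo (i + 1) (by omega) (i - 1) (by omega) (by omega)
        ((hadj _ hi _ (by omega)).2 (by omega)) ((hadj _ hi _ (by omega)).2 (by omega))
  have hvadj : ∀ j < s, (G.Adj v (φ j) ↔ j + 1 = s) := by
    intro j hj
    constructor
    · intro h
      have h1 : φ j ∈ G.nbrIn v S := mem_nbrIn.2 ⟨erase_subset _ _ (hmem j hj), h⟩
      rw [hN, mem_singleton, ← hiw] at h1
      have := hinj (by simpa using hj) (by simpa using hi) h1
      omega
    · intro h
      rw [show j = i by omega, hiw]
      exact hvw
  have hold : ∀ j < s, (Function.update φ s v) j = φ j := fun j hj =>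
    Function.update_of_ne hj.ne _ _
  have hnew : (Function.update φ s v) s = v := Function.update_self ..
  refine ⟨Function.update φ s v, ?_, ?_⟩
  · rw [← hcard, range_add_one, image_insert, hnew,
      image_congr (g := φ) (fun j hj => hold j (by simpa using hj)), ← hφ, insert_erase hv]
  · intro j hj k hk
    rcases (by omega : j < s ∨ j = s) with hj' | rfl <;>
      rcases (by omega : k < s ∨ k = s) with hk' | hk'
    · rw [hold j hj', hold k hk']
      exact hadj j hj' k hk'
    · rw [hold j hj', hk', hnew, G.adj_comm, hvadj j hj']
      omega
    · rw [hold k hk', hnew, hvadj k hk']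
      omega
    · rw [hk', hnew]
      simp only [SimpleGraph.irrefl, false_iff]
      omega

/-- The average degree is 2, so without leaves every degree would equal 2. -/
lemma exists_card_nbrIn_eq_one {S : Finset V} (hc : G.ConnOn S) (hS : 2 ≤ #S)
    (hd : G.degSum S = 2 * #S) (h : ¬ ∀ v ∈ S, #(G.nbrIn v S) = 2) :
    ∃ v ∈ S, #(G.nbrIn v S) = 1 := by
  by_contra hcon
  push Not at hcon
  refine h fun v hv => ?_
  have hge : ∀ v ∈ S, 2 ≤ #(G.nbrIn v S) := fun v hv => by
    have h1 := (hc.nbrIn_nonempty hS hv).card_pos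
    have h2 := hcon v hv
    omega
  have hsum : ∑ _a ∈ S, 2 = ∑ a ∈ S, #(G.nbrIn a S) := by
    rw [sum_const, smul_eq_mul, mul_comm]
    exact hd.symm
  exact ((sum_eq_sum_iff_of_le hge).1 hsum v hv).symm

/-- Equality in the bound by cycles. -/
theorem ConnOn.regular_or_isTadpoleOn {S : Finset V} (hc : G.ConnOn S) {m : ℕ} (hm : #S = m + 3)
    (hd : G.degSum S = 2 * #S) (hP : G.indepPolyOn S = cycleSeq (-X) #S) :
    (∀ v ∈ S, #(G.nbrIn v S) = 2) ∨ G.IsTadpoleOn S := by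
  induction m generalizing S with
  | zero =>
    left
    by_contra hreg
    obtain ⟨v, hv, hN⟩ := exists_card_nbrIn_eq_one hc (by omega) hd hreg
    have hds := degSum_erase (G := G) hv
    have hcard := card_erase_add_one hv
    have h1 := degSum_le (G := G) (S.erase v)
    rw [show #(S.erase v) = 2 by omega] at h1
    omega
  | succ m ih =>
    by_cases hreg : ∀ v ∈ S, #(G.nbrIn v S) = 2
    · exact Or.inl hreg
    right
    obtain ⟨v, hv, hN⟩ := exists_card_nbrIn_eq_one hc (by omega) hd hreg
    have hvc := hc.erase_of_card_nbrIn_eq_one hv hN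
    have hds := degSum_erase (G := G) hv
    have hcard := card_erase_add_one hv
    obtain ⟨w, hw⟩ := card_eq_one.1 hN
    -- The ratio bound with I(S) = C_n gives I(S - v) ≥ C_{n-1}, the reverse of the cycle bound for
    -- S - v.
    have hP' : G.indepPolyOn (S.erase v) = cycleSeq (-X) #(S.erase v) := by
      obtain ⟨δ, hδ, h⟩ := exists_posOn (G := G) S
      refine polynomial_ext_of_eval_neg hδ fun t ht htδ => ?_
      have hpos := h t ht htδ
      rw [eval_cycleSeq]
      change G.indepVal (S.erase v) t = _
      refine le_antisymm (hvc.indepVal_le_cycleSeq (hpos.mono (erase_subset _ _)) (by omega)) ?_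
      obtain ⟨k, hk, h1, h2⟩ := hc.indepVal_mul_cycleSeq_le hpos hd.ge hv
      have h3 : G.indepVal S t = cycleSeq t (k + 3) := by
        rw [indepVal, hP, eval_cycleSeq, hk]
      rw [h3] at h2
      rw [show #(S.erase v) = k + 2 by omega]
      exact le_of_mul_le_mul_left h2 (h1 _ le_rfl)
    rcases Nat.eq_zero_or_pos m with rfl | hm0
    · exact isTadpoleOn_of_triangle hv (by omega) hd hw
    obtain ⟨k, rfl⟩ : ∃ k, m = k + 1 := Nat.exists_eq_add_one.2 hm0
    have hPw : G.indepPolyOn (S.erase v \ G.nbrIn v S) = cycleSeq (-X) (k + 3) := by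
      have h1 := indepPolyOn_erase (G := G) hv
      rw [hP, hP', hm, show #(S.erase v) = k + 3 + 1 by omega,
        show k + 1 + 1 + 3 = k + 3 + 2 by ring, cycleSeq_add_two] at h1
      have h2 : (X : ℝ[X]) * G.indepPolyOn (S.erase v \ G.nbrIn v S) =
          X * cycleSeq (-X) (k + 3) := by
        linear_combination -h1
      exact mul_left_cancel₀ X_ne_zero h2
    have hc' := card_erase_sdiff_nbrIn (G := G) hv
    have hco := (two_mul_coeff_two_indepPolyOn (G := G) (S.erase v \ G.nbrIn v S)).2.2
    rw [hPw, two_mul_coeff_two_cycleSeq,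
      show #(S.erase v \ G.nbrIn v S) = k + 3 by omega] at hco
    -- Without `v` and `w` there are again as many edges as vertices, so `w` has degree 1 in S - v;
    -- this rules out the 2-regular alternative there.
    have hdeg : G.degSum (S.erase v \ G.nbrIn v S) = 2 * (k + 3) := by
      have : (G.degSum (S.erase v \ G.nbrIn v S) : ℝ) = 2 * ((k : ℝ) + 3) := by
        push_cast at hco
        linarith
      exact_mod_cast this
    have hwS : w ∈ S.erase v := by
      have : w ∈ G.nbrIn v (S.erase v) := by rw [nbrIn_erase_self, hw]; simp
      exact nbrIn_subset _ _ this
    rw [hw, sdiff_singleton_eq_erase] at hdeg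
    have hds2 := degSum_erase (G := G) hwS
    have hw1 : #(G.nbrIn w (S.erase v)) = 1 := by omega
    rcases ih hvc (by omega) (by omega) hP' with h | h
    · rw [h w hwS] at hw1
      omega
    · exact h.of_erase hv (by omega) hw hw1

lemma nonempty_iso_graphD [Fintype V] (h : G.IsTadpoleOn univ) :
    Nonempty (G ≃g graphD (Fintype.card V)) := by
  obtain ⟨φ, hφ, hadj⟩ := h
  rw [card_univ] at hφ hadj
  have hsurj : Function.Surjective fun i : Fin (Fintype.card V) => φ i := by
    intro x
    have hx := mem_univ x
    rw [hφ, mem_image] at hx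
    obtain ⟨i, hi, rfl⟩ := hx
    exact ⟨⟨i, mem_range.1 hi⟩, rfl⟩
  have hbij := (Fintype.bijective_iff_surjective_and_card _).2 ⟨hsurj, by simp⟩
  refine ⟨RelIso.symm ⟨Equiv.ofBijective _ hbij, ?_⟩⟩
  intro i j
  change G.Adj (φ i) (φ j) ↔ _
  rw [hadj _ i.2 _ j.2, graphD, fromRel_adj, ne_eq, Fin.ext_iff]
  omega

end CycleEquality

/-! ### The root ξ and the order on graphs. -/

section Main

variable {V : Type*} [Fintype V] [DecidableEq V] (G : SimpleGraph V) [DecidableRel G.Adj]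

/-- `ξ(G)` is well defined and `-ξ(G)` is the first zero of `t ↦ I(G, -t)` on `[0, ∞)`. -/
lemma xi_spec [Nonempty V] :
    G.IsMinModulusIndepRoot G.xi ∧ G.xi < 0 ∧ G.indepVal univ (-G.xi) = 0 ∧
      ∀ x, 0 ≤ x → x < -G.xi → 0 < G.indepVal univ x := by
  obtain ⟨r, hr, hr0, hpos⟩ := exists_first_root (G := G) (univ_nonempty (α := V))
  have hex : G.IsMinModulusIndepRoot (-r) := by
    unfold IsMinModulusIndepRoot
    rw [indepPoly_eq_indepPolyOn]
    refine ⟨?_, fun z hz => ?_⟩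
    · rw [← Complex.coe_algebraMap, aeval_algebraMap_apply]
      rw [indepVal] at hr0
      simp [hr0]
    · by_contra hlt
      rw [not_le, Complex.norm_real, norm_neg, Real.norm_of_nonneg hr.le] at hlt
      exact (posOn_of_pos (norm_nonneg z) fun s hs hsz =>
        hpos s hs (hsz.trans_lt hlt)).aeval_ne_zero le_rfl hz
  have hxi : G.IsMinModulusIndepRoot G.xi := Classical.epsilon_spec (p := _) ⟨_, hex⟩
  have hroot : G.indepVal univ (-G.xi) = 0 := by
    have h1 := hxi.1
    rw [indepPoly_eq_indepPolyOn, ← Complex.coe_algebraMap, aeval_algebraMap_apply,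
      Complex.coe_algebraMap, Complex.ofReal_eq_zero] at h1
    rw [indepVal, neg_neg]
    simpa using h1
  have hle : ‖G.xi‖ ≤ r := by
    have h1 := hxi.2 _ hex.1
    rwa [Complex.norm_real, Complex.norm_real, norm_neg, Real.norm_of_nonneg hr.le] at h1
  have hneg : G.xi < 0 := by
    by_contra hge
    rw [not_lt] at hge
    -- At a nonnegative argument all terms are nonnegative and the empty set contributes 1, so no
    -- root lies there.
    have h1 : 1 ≤ G.indepVal univ (-G.xi) := by
      rw [indepVal, neg_neg, indepPolyOn, eval_finsetSum]
      refine le_trans ?_ (single_le_sum (f := fun T : Finset V => eval G.xi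
        (if G.IsIndepSet (T : Set V) then X ^ #T else 0)) (fun T _ => ?_) (empty_mem_powerset _))
      · simp
      · split_ifs <;> simp [hge]
    rw [hroot] at h1
    linarith
  refine ⟨hxi, hneg, hroot, fun x hx hlt => hpos x hx ?_⟩
  rw [Real.norm_of_nonpos hneg.le] at hle
  linarith

variable {G} {W : Type*} [Fintype W] [DecidableEq W] {H : SimpleGraph W} [DecidableRel H.Adj]

/-- The comparison is needed only before the first zero of `G`; the endpoint ξ(G) follows by
continuity. -/
lemma indepLE_of_forall [Nonempty V]
    (h : ∀ t, 0 ≤ t → (∀ s, 0 ≤ s → s ≤ t → 0 < G.indepVal univ s) →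
      G.indepVal univ t ≤ H.indepVal univ t) : H.IndepLE G := by
  obtain ⟨-, hneg, -, hpos⟩ := G.xi_spec
  intro x hx
  rw [indepPoly_eq_indepPolyOn, indepPoly_eq_indepPolyOn]
  have key : ∀ t, 0 ≤ t → t < -G.xi → 0 ≤ H.indepVal univ t - G.indepVal univ t :=
    fun t ht hlt => sub_nonneg.2 (h t ht fun s hs hst => hpos s hs (hst.trans_lt hlt))
  have hx' : 0 ≤ H.indepVal univ (-x) - G.indepVal univ (-x) := by
    rcases hx.1.eq_or_lt with he | hlt
    · rw [← he]
      exact nonneg_of_nonneg_on_Ico ((continuous_indepVal _).sub (continuous_indepVal _))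
        (by linarith) key
    · exact key _ (by linarith [hx.2]) (by linarith)
  simpa [indepVal] using hx'

/-- Otherwise I(G) would be positive at ξ(H), where I(H) vanishes although it dominates I(G). -/
lemma IndepLE.xi_le [Nonempty V] [Nonempty W] (h : H.IndepLE G) : H.xi ≤ G.xi := by
  obtain ⟨-, hneg, -, hpos⟩ := G.xi_spec
  obtain ⟨-, hneg', hroot, -⟩ := H.xi_spec
  by_contra hlt
  rw [not_le] at hlt
  have h1 := h H.xi ⟨hlt.le, hneg'.le⟩
  have h2 := hpos (-H.xi) (by linarith) (by linarith)
  rw [indepPoly_eq_indepPolyOn, indepPoly_eq_indepPolyOn] at h1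
  rw [indepVal, neg_neg] at h2 hroot
  linarith

end Main

end SimpleGraph

theorem mainTheorem1 {V : Type*} [Finite V] (G : SimpleGraph V) (n : ℕ) (hn : Nat.card V = n)
    (hconn : G.Connected) (huni : G.IsUnicyclic) :
    -- `ξ` is well defined: it is a real independence root of smallest modulus
    ((SimpleGraph.cycleGraph n).IsMinModulusIndepRoot (SimpleGraph.cycleGraph n).xi ∧
      G.IsMinModulusIndepRoot G.xi ∧
      (SimpleGraph.graphU n).IsMinModulusIndepRoot (SimpleGraph.graphU n).xi) ∧
    -- `C_n ≺ G ≺ U_n` unless `G` is one of `C_n`, `D_n`, `U_n`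
    (¬ Nonempty (G ≃g SimpleGraph.cycleGraph n) →
      ¬ Nonempty (G ≃g SimpleGraph.graphD n) →
      ¬ Nonempty (G ≃g SimpleGraph.graphU n) →
      (SimpleGraph.cycleGraph n).IndepLT G ∧ G.IndepLT (SimpleGraph.graphU n)) ∧
    -- `ξ(C_n) ≤ ξ(G) ≤ ξ(U_n)` in all cases
    ((SimpleGraph.cycleGraph n).xi ≤ G.xi ∧ G.xi ≤ (SimpleGraph.graphU n).xi) := by
  classical
  have := Fintype.ofFinite V
  rw [Nat.card_eq_fintype_card] at hn
  have hc := hconn.connOn_univ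
  have hd := huni.degSum_univ hconn
  have hcardn : Finset.card (Finset.univ : Finset V) = n := by rw [Finset.card_univ, hn]
  have hne : Nonempty V := hconn.nonempty
  have hn3 : 3 ≤ n := by
    obtain ⟨C, ⟨u, p, hp, -⟩, -⟩ := huni
    have h1 := List.toFinset_card_of_nodup hp.support_nodup
    have h2 := Finset.card_le_univ p.support.tail.toFinset
    have h3 := hp.three_le_length
    rw [List.length_tail, SimpleGraph.Walk.length_support] at h1
    omega
  obtain ⟨m, rfl⟩ := Nat.exists_eq_add_of_le' hn3
  have hUval : ∀ t, (SimpleGraph.graphU (m + 3)).indepVal Finset.univ t =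
      (1 - t) ^ m * (1 - 2 * t) - t := fun t => by
    rw [SimpleGraph.indepVal, SimpleGraph.indepPolyOn_graphU]
    simp only [Polynomial.eval_add, Polynomial.eval_mul, Polynomial.eval_pow,
      Polynomial.eval_one, Polynomial.eval_X, Polynomial.eval_C]
    ring
  have hCG : (SimpleGraph.cycleGraph (m + 3)).IndepLE G := by
    refine SimpleGraph.indepLE_of_forall fun t ht hpos => ?_
    have h1 := hc.indepVal_le_cycleSeq (SimpleGraph.posOn_of_pos ht hpos) hd.ge
    rw [hcardn] at h1
    rwa [SimpleGraph.indepVal, SimpleGraph.indepVal, SimpleGraph.indepPolyOn_cycleGraph,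
      SimpleGraph.eval_cycleSeq]
  have hGU : G.IndepLE (SimpleGraph.graphU (m + 3)) := by
    refine SimpleGraph.indepLE_of_forall fun t ht hpos => ?_
    -- The value of U_n at t = 1/2 is -1/2, so positivity up to t keeps t below 1/2.
    have ht1 : 2 * t ≤ 1 := by
      by_contra hlt
      have h1 := hpos (1 / 2) (by norm_num) (by linarith)
      rw [hUval] at h1
      norm_num at h1
    have h2 := hpos t ht le_rfl
    rw [hUval] at h2 ⊢
    exact hc.indepVal_ge_of_unicyclic hcardn hd ht ht1 h2
  refine ⟨⟨(SimpleGraph.xi_spec _).1, (SimpleGraph.xi_spec _).1, (SimpleGraph.xi_spec _).1⟩,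
    fun hnC hnD hnU => ⟨⟨hCG, fun heq => ?_⟩, hGU, fun heq => ?_⟩, hCG.xi_le, hGU.xi_le⟩
  · rw [SimpleGraph.indepPoly_eq_indepPolyOn, SimpleGraph.indepPoly_eq_indepPolyOn,
      SimpleGraph.indepPolyOn_cycleGraph] at heq
    rcases hc.regular_or_isTadpoleOn hcardn hd (by rw [← heq, hcardn]) with h | h
    · exact hnC (hn ▸ SimpleGraph.nonempty_iso_cycleGraph hconn (by omega)
        fun v => h v (Finset.mem_univ v))
    · exact hnD (hn ▸ SimpleGraph.nonempty_iso_graphD h)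
  · rw [SimpleGraph.indepPoly_eq_indepPolyOn, SimpleGraph.indepPoly_eq_indepPolyOn,
      SimpleGraph.indepPolyOn_graphU] at heq
    -- A 2-regular `G` is the excluded cycle; otherwise there is a leaf, whose neighbour dominates
    -- the graph.
    by_cases hreg : ∀ v ∈ (Finset.univ : Finset V), (G.nbrIn v Finset.univ).card = 2
    · exact hnC (hn ▸ SimpleGraph.nonempty_iso_cycleGraph hconn (by omega)
        fun v => hreg v (Finset.mem_univ v))
    · obtain ⟨v, hv, hN⟩ := SimpleGraph.exists_card_nbrIn_eq_one hc (by omega) hd hreg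
      obtain ⟨w, hw⟩ := Finset.card_eq_one.1 hN
      have hdom := hc.adj_of_indepPolyOn_eq hcardn hd heq hv hw
      exact hnU (hn ▸ SimpleGraph.nonempty_iso_graphU (by omega)
        (by rw [hd, Finset.card_univ]) fun a ha => hdom a (Finset.mem_univ a) ha)
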